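/- **Setting.** $M$ is a finite nonempty set of machines and $J$ a finite set of jobs; job $j$ has weight $w_j\ge 0$ and needs processing time $p_{ij}\ge 0$ on machine $i$. For every $i$ fix a Smith ordering $\preceq_i$, a linear order of $J$ by non-increasing ratio $w_j/p_{ij}$, ties broken arbitrarily (jobs with $p_{ij}=0<w_j$ have ratio $+\infty$, jobs with $w_j=p_{ij}=0$ may stand anywhere). An assignment $a:J\to M$ gives the schedule in which each machine processes its jobs in Smith order; its cost is $$\sum_{j\in J} w_jC_j,\qquad C_j=\sum_{j':\ a(j')=a(j),\ j'\preceq_{a(j)}j}p_{a(j)j'} .$$ **Relaxation (SDP).** The variables are $x_\emptyset$ and $x_{\{ij\}\cup\{ij'\}}$ ($i\in M$, $j,j'\in J$), with $x_{ij}:=x_{\{ij\}}$. For $i\in M$ let $X^{(i)}$ be the matrix indexed by $\emptyset$ and the $\{ij\}$, $j\in J$, with entries $X^{(i)}_{S,T}=x_{S\cup T}$. Minimize $$\sum_{i\in M}\sum_{j\in J}w_j\sum_{j'\preceq_i j}p_{ij'}\,x_{\{ij\}\cup\{ij'\}}$$ subject to $\sum_{i}x_{ij}=1$ for all $j$, $X^{(i)}\succeq0$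 for all $i$, $x_\emptyset=1$, and all entries of all $X^{(i)}$ nonnegative. **Algorithm.** Let $x$ be an optimal solution of the SDP, $y_{ij}=x_{ij}$, and let $G$ be the bipartite graph on $M\cup J$ with edge set $E=\{ij: y_{ij}>0\}$; $\delta(v)$ is the set of edges at $v$. *Grouping.* On machine $i$, a job $j$ with $ij\in E$ is in class $k\in\mathbb Z$ if $p_{ij}\in[10^{k-1},10^k)$. In each class every job with $y_{ij}\ge 1/10$ forms a group by itself. The other jobs of the class are picked in the order $\preceq_i$; as soon as the picked jobs have total $y$-value at least $1/10$ they form a group and one starts afresh, until the remaining jobs of the class have total $y$-value less than $1/10$ (these stay ungrouped). *Rounding, Phase 1.* For each job $v$ partition $\delta(v)$ into at most six sets, each a minimal set of total $y$-value at least $1/6$, except that at most one of them may have total $y$-value less than $1/6$. Select one of the sets uniformly at random, independently for each $v$; $R$ is the union of the selected sets. *Phase 2.* While there are edges $uv_1\ne uv_2$ in $R$ whose jobs $v_1,v_2$ lie in a common group of machine $u$, and edges $u_1v_1,u_2v_2\in E\setminus R$, all four with $y$-values in $(0,1)$, choose such edges (arbitrarily) and set $$\alpha=\min\{y_{u_1v_1},1-y_{uv_1},y_{uv_2},1-y_{u_2v_2}\},\qquad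 \beta=\min\{1-y_{u_1v_1},y_{uv_1},1-y_{uv_2},y_{u_2v_2}\}.$$ With probability $\frac{\alpha}{\alpha+\beta}$ increase $y_{u_1v_1},y_{uv_2}$ and decrease $y_{uv_1},y_{u_2v_2}$ by $\beta$; otherwise decrease $y_{u_1v_1},y_{uv_2}$ and increase $y_{uv_1},y_{u_2v_2}$ by $\alpha$. Then, for $v\in\{v_1,v_2\}$, if $\sum_{e\in\delta(v)\cap R}y_e=1$, remove from $R$ all edges of $\delta(v)\cap R$ but one of largest $y$-value. *Phase 3.* Assign each job $v$, independently, to machine $u$ with probability $y_{uv}$, where $y$ denotes the values at the end of Phase 2. **Theorem.** Let $\zeta=1/108$ and $c=\zeta/20000$. The SDP has an optimal solution, and from every optimal solution the algorithm can be run to the end. For every optimal solution $x$ and all choices that the algorithm leaves arbitrary, the expected cost of the resulting schedule is at most $\left(\tfrac32-c\right)$ times the cost of $x$, the optimal value of the SDP. -/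

import Mathlib

open Finset

noncomputable section

/-! ### Scheduling on unrelated machines

`M` is the set of machines, `J` the set of jobs, `w j` the weight of job `j` and `p i j` the
processing time of job `j` on machine `i`. -/

/-- `r i` enumerates the jobs in a Smith ordering of machine `i`, that is, in non-increasing order
of `w j / p i j` (ties broken in a fixed way): `j'` comes before `j` on machine `i` iff
`r i j' < r i j`.  The comparison of ratios is cross-multiplied, so that a job with `p i j = 0` and
`w j > 0` has ratio `+∞`, and a job with `w j = p i j = 0` may stand anywhere. -/
structure IsSmithOrder {M J : Type*} (w : J → ℝ) (p : M → J → ℝ) (r : M → J → ℕ) : Prop where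
  injective : ∀ i, Function.Injective (r i)
  ratio : ∀ i j j', r i j' < r i j → w j * p i j' ≤ w j' * p i j

/-- Completion time of job `j` if the jobs are assigned to machines by `a` and every machine
processes its jobs in its Smith ordering. -/
def completionTime {M J : Type*} [Fintype J] [DecidableEq M]
    (p : M → J → ℝ) (r : M → J → ℕ) (a : J → M) (j : J) : ℝ :=
  ∑ j' ∈ univ.filter (fun j' => a j' = a j ∧ r (a j) j' ≤ r (a j) j), p (a j) j'

/-- Total weighted completion time of the schedule given by the assignment `a`. -/
def scheduleCost {M J : Type*} [Fintype J] [DecidableEq M]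
    (w : J → ℝ) (p : M → J → ℝ) (r : M → J → ℕ) (a : J → M) : ℝ :=
  ∑ j, w j * completionTime p r a j

/-- Expected cost of the schedule given by a random assignment with law `μ`. -/
def expectedCost {M J : Type*} [Fintype M] [Fintype J] [DecidableEq M] [DecidableEq J]
    (w : J → ℝ) (p : M → J → ℝ) (r : M → J → ℕ) (μ : PMF (J → M)) : ℝ :=
  ∑ a : J → M, (μ a).toReal * scheduleCost w p r a

/-! ### The semidefinite relaxation

A vector of variables is `x : M → Finset J → ℝ`: `x i {j}` is the variable `x_{ij}`,
`x i ({j} ∪ {j'})` is the variable `x_{{ij} ∪ {ij'}}`, and `x i ∅` is `x_∅`.  Sets with more than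
two elements do not occur in the program. -/

/-- The matrix `X^{(i)}`, with rows and columns indexed by `∅` (`none`) and the singletons `{j}`
(`some j`) and entries `X^{(i)}_{S,T} = x_{S ∪ T}`. -/
def momentMatrix {M J : Type*} [DecidableEq J] (x : M → Finset J → ℝ) (i : M) :
    Matrix (Option J) (Option J) ℝ :=
  Matrix.of fun s t => x i (s.toFinset ∪ t.toFinset)

/-- Feasible solutions of the semidefinite program. -/
structure SDPFeasible {M J : Type*} [Fintype M] [Fintype J] [DecidableEq J]
    (x : M → Finset J → ℝ) : Prop where
  assigned : ∀ j, ∑ i, x i {j} = 1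
  posSemidef : ∀ i, (momentMatrix x i).PosSemidef
  empty_eq_one : ∀ i, x i ∅ = 1
  nonneg : ∀ i s t, 0 ≤ momentMatrix x i s t

/-- Objective function of the semidefinite program. -/
def sdpValue {M J : Type*} [Fintype M] [Fintype J] [DecidableEq J]
    (w : J → ℝ) (p : M → J → ℝ) (r : M → J → ℕ) (x : M → Finset J → ℝ) : ℝ :=
  ∑ i, ∑ j, w j * ∑ j' ∈ univ.filter (fun j' => r i j' ≤ r i j), p i j' * x i ({j} ∪ {j'})

/-- Optimal solutions of the semidefinite program. -/
def IsSDPOptimal {M J : Type*} [Fintype M] [Fintype J] [DecidableEq J]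
    (w : J → ℝ) (p : M → J → ℝ) (r : M → J → ℕ) (x : M → Finset J → ℝ) : Prop :=
  SDPFeasible x ∧ ∀ x' : M → Finset J → ℝ, SDPFeasible x' → sdpValue w p r x ≤ sdpValue w p r x'

/-! ### The grouping procedure

`y i j` is the fractional assignment of job `j` to machine `i`; the edges of the bipartite graph
are the pairs with `y i j > 0`. -/

/-- The jobs of size class `k` on machine `i` that have an edge to `i`. -/
def classJobs {M J : Type*} [Fintype J] (p y : M → J → ℝ) (i : M) (k : ℤ) : Finset J :=
  univ.filter fun j => 0 < y i j ∧ (10 : ℝ) ^ (k - 1) ≤ p i j ∧ p i j < (10 : ℝ) ^ k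

/-- `GreedyGroups z r S 𝒢`: going through the jobs of `S` by increasing `r`, and closing a group
as soon as its total `z`-value reaches `1/10`, until the remaining jobs have total value less than
`1/10`, produces the groups `𝒢`. -/
inductive GreedyGroups {J : Type*} [DecidableEq J] (z : J → ℝ) (r : J → ℕ) :
    Finset J → Finset (Finset J) → Prop
  | finish (S : Finset J) (h : ∑ j ∈ S, z j < 1 / 10) : GreedyGroups z r S ∅
  | pick (S T : Finset J) (𝒢 : Finset (Finset J)) (sub : T ⊆ S)
      (initial : ∀ j ∈ T, ∀ j' ∈ S \ T, r j < r j')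
      (reached : 1 / 10 ≤ ∑ j ∈ T, z j)
      (first : ∀ j ∈ T, (∀ j' ∈ T, r j' ≤ r j) → ∑ j' ∈ T.erase j, z j' < 1 / 10)
      (rest : GreedyGroups z r (S \ T) 𝒢) : GreedyGroups z r S (insert T 𝒢)

/-- `𝒢` is the family of groups formed on machine `i`: in each class, every job of value at least
`1/10` is a group by itself, and the other jobs are grouped greedily in the Smith ordering. -/
def IsGrouping {M J : Type*} [Fintype J] [DecidableEq J]
    (p : M → J → ℝ) (r : M → J → ℕ) (y : M → J → ℝ) (i : M) (𝒢 : Finset (Finset J)) : Prop :=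
  ∃ 𝒮 : ℤ → Finset (Finset J),
    (∀ k, GreedyGroups (y i) (r i) ((classJobs p y i k).filter fun j => y i j < 1 / 10) (𝒮 k)) ∧
    ∀ S : Finset J, S ∈ 𝒢 ↔
      ∃ k, S ∈ 𝒮 k ∨ ∃ j ∈ classJobs p y i k, 1 / 10 ≤ y i j ∧ S = {j}

/-! ### The bipartite rounding procedure

A set `R` of edges is given by the sets `R v` of those machines `u` for which the edge `{u, v}` is
in `R`. -/

/-- Phase 1, the groups at a job `v`: a partition of the edges at `v` into at most six sets, each
of them a minimal set of total value at least `1/6`, except that at most one of them may have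
total value less than `1/6`. -/
structure IsEdgePartition {M J : Type*} [Fintype M] [DecidableEq M] (y : M → J → ℝ) (v : J)
    (P : Finpartition (univ.filter fun u : M => 0 < y u v)) : Prop where
  card_le : #P.parts ≤ 6
  minimal : ∀ S ∈ P.parts, 1 / 6 ≤ ∑ u ∈ S, y u v →
    Minimal (fun T : Finset M => 1 / 6 ≤ ∑ u ∈ T, y u v) S
  exceptional : ∀ S ∈ P.parts, ∀ T ∈ P.parts,
    ∑ u ∈ S, y u v < 1 / 6 → ∑ u ∈ T, y u v < 1 / 6 → S = T

/-- A value is floating if it lies strictly between `0` and `1`. -/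
def Floating (z : ℝ) : Prop := 0 < z ∧ z < 1

/-- Phase 2 can use the edges `{u, v₁}`, `{u, v₂}` (in `R` and in a common group of `u`) and
`{u₁, v₁}`, `{u₂, v₂}` (not in `R`), which all have floating values. -/
structure IsPivot {M J : Type*} (G : M → Finset (Finset J)) (y : M → J → ℝ) (R : J → Finset M)
    (u : M) (v₁ v₂ : J) (u₁ u₂ : M) : Prop where
  ne : v₁ ≠ v₂
  mem₁ : u ∈ R v₁
  mem₂ : u ∈ R v₂
  same_group : ∃ S ∈ G u, v₁ ∈ S ∧ v₂ ∈ S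
  notMem₁ : u₁ ∉ R v₁
  notMem₂ : u₂ ∉ R v₂
  floating_uv₁ : Floating (y u v₁)
  floating_uv₂ : Floating (y u v₂)
  floating_u₁v₁ : Floating (y u₁ v₁)
  floating_u₂v₂ : Floating (y u₂ v₂)

/-- The step size `α` of Phase 2. -/
def stepAlpha {M J : Type*} (y : M → J → ℝ) (u : M) (v₁ v₂ : J) (u₁ u₂ : M) : ℝ :=
  min (min (y u₁ v₁) (1 - y u v₁)) (min (y u v₂) (1 - y u₂ v₂))

/-- The step size `β` of Phase 2. -/
def stepBeta {M J : Type*} (y : M → J → ℝ) (u : M) (v₁ v₂ : J) (u₁ u₂ : M) : ℝ :=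
  min (min (1 - y u₁ v₁) (y u v₁)) (min (1 - y u v₂) (y u₂ v₂))

/-- Add `t` on the edges `{u₁, v₁}`, `{u, v₂}` and subtract `t` on `{u, v₁}`, `{u₂, v₂}`. -/
def shiftEdges {M J : Type*} [DecidableEq M] [DecidableEq J] (y : M → J → ℝ)
    (u : M) (v₁ v₂ : J) (u₁ u₂ : M) (t : ℝ) : M → J → ℝ := fun i j =>
  if (i = u₁ ∧ j = v₁) ∨ (i = u ∧ j = v₂) then y i j + t
  else if (i = u ∧ j = v₁) ∨ (i = u₂ ∧ j = v₂) then y i j - t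
  else y i j

/-- Last step of an iteration of Phase 2: for `v ∈ {v₁, v₂}`, if the edges at `v` in `R` have total
value `1`, all of them but one of largest value are removed from `R`; the result is `R'`. -/
structure IsReduction {M J : Type*} (y : M → J → ℝ) (R : J → Finset M) (v₁ v₂ : J)
    (R' : J → Finset M) : Prop where
  other : ∀ v, v ≠ v₁ → v ≠ v₂ → R' v = R v
  keep : ∀ v, v = v₁ ∨ v = v₂ → ∑ i ∈ R v, y i v ≠ 1 → R' v = R v
  reduce : ∀ v, v = v₁ ∨ v = v₂ → ∑ i ∈ R v, y i v = 1 →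
    ∃ i ∈ R v, (∀ i' ∈ R v, y i' v ≤ y i v) ∧ R' v = {i}

/-- `IsRoundedFrom G y R μ`: the law of the assignment obtained by running Phases 2 and 3 from the
values `y` and the edge set `R` is `μ`, for some way of making the choices that are arbitrary (the
edges used in an iteration, which may depend on all that happened before, and the edge of largest
value that is kept).

* `finish`: no further iteration of Phase 2 is possible, and Phase 3 assigns every job `v`
  independently to machine `u` with probability `y u v`.
* `step`: an iteration of Phase 2 moves to one of two states, with probabilities `α / (α + β)` and
  `β / (α + β)`, and the procedure goes on from there. -/
inductive IsRoundedFrom {M J : Type*} [Fintype J] [DecidableEq M] [DecidableEq J]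
    (G : M → Finset (Finset J)) : (M → J → ℝ) → (J → Finset M) → PMF (J → M) → Prop
  | finish (y : M → J → ℝ) (R : J → Finset M) (μ : PMF (J → M))
      (final : ∀ u v₁ v₂ u₁ u₂, ¬ IsPivot G y R u v₁ v₂ u₁ u₂)
      (law : ∀ a : J → M, μ a = ENNReal.ofReal (∏ v, y (a v) v)) : IsRoundedFrom G y R μ
  | step (y : M → J → ℝ) (R : J → Finset M) (u : M) (v₁ v₂ : J) (u₁ u₂ : M)
      (pivot : IsPivot G y R u v₁ v₂ u₁ u₂) (α β : ℝ)
      (hα : α = stepAlpha y u v₁ v₂ u₁ u₂) (hβ : β = stepBeta y u v₁ v₂ u₁ u₂)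
      (y₁ y₂ : M → J → ℝ)
      (hy₁ : y₁ = shiftEdges y u v₁ v₂ u₁ u₂ β) (hy₂ : y₂ = shiftEdges y u v₁ v₂ u₁ u₂ (-α))
      (R₁ R₂ : J → Finset M)
      (hR₁ : IsReduction y₁ R v₁ v₂ R₁) (hR₂ : IsReduction y₂ R v₁ v₂ R₂)
      (μ₁ μ₂ μ : PMF (J → M))
      (run₁ : IsRoundedFrom G y₁ R₁ μ₁) (run₂ : IsRoundedFrom G y₂ R₂ μ₂)
      (law : ∀ a : J → M, μ a =
        ENNReal.ofReal (α / (α + β)) * μ₁ a + ENNReal.ofReal (β / (α + β)) * μ₂ a) :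
      IsRoundedFrom G y R μ

/-- `μ` is the law of the assignment produced by the bipartite rounding procedure from the
fractional assignment `y` and the groups `G`.  Phase 1 selects one part of the edge partition at
each job uniformly at random and independently, which is a uniform element of the product. -/
def IsBipartiteRounding {M J : Type*} [Fintype M] [Fintype J] [DecidableEq M] [DecidableEq J]
    (G : M → Finset (Finset J)) (y : M → J → ℝ) (μ : PMF (J → M)) : Prop :=
  ∃ P : ∀ v : J, Finpartition (univ.filter fun u : M => 0 < y u v),
    (∀ v, IsEdgePartition y v (P v)) ∧
    ∃ hne : (Fintype.piFinset fun v => (P v).parts).Nonempty,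
    ∃ ρ : (J → Finset M) → PMF (J → M),
      (∀ R ∈ Fintype.piFinset (fun v => (P v).parts), IsRoundedFrom G y R (ρ R)) ∧
      μ = (PMF.uniformOfFinset (Fintype.piFinset fun v => (P v).parts) hne).bind ρ

/-- `μ` is the law of the assignment produced by the scheduling algorithm from the solution `x` of
the semidefinite program: form the groups on every machine, then round. -/
def IsAlgorithmOutput {M J : Type*} [Fintype M] [Fintype J] [DecidableEq M] [DecidableEq J]
    (p : M → J → ℝ) (r : M → J → ℕ) (x : M → Finset J → ℝ) (μ : PMF (J → M)) : Prop :=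
  ∃ G : M → Finset (Finset J),
    (∀ i, IsGrouping p r (fun i j => x i {j}) i (G i)) ∧
    IsBipartiteRounding G (fun i j => x i {j}) μ

/-- The constant `ζ` of the bipartite rounding procedure. -/
def zetaConst : ℝ := 1 / 108

end

/-! The expected cost is the sum over machines `i` of `w j * p i j'` times the probability that `j`
and `j'` both land on `i`, over pairs with `j'` not after `j`. So the theorem reduces to bounds on
pair probabilities and a comparison with the SDP on each machine separately.

Rounding. Every step of Phase 2 is a centered two-point move in which edges at one machine never
move in the same direction. Hence marginals are kept and pair probabilities are at most `y u a * y u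
b`. For two jobs of a common group a saving by the factor `1 - zetaConst` comes from a
supermartingale, `pairPotential`: the product of the two values times the value of the other edges
of `R` at both jobs. When Phase 2 stops with both edges still in `R`, the product is zero. If one
edge leaves `R` earlier, the edges of `R` at its job have total value 1 and the potential already
pays for the product (`IsRoundedFrom.pairProb_le_potential`). Both edges lie in the initial `R` with
probability at least 1/36 (`IsBipartiteRounding.pairProb_le_of_group`).

One machine. Abel summation over the decreasing ratios `w j / p i j` reduces arbitrary weights to
prefixes of the Smith order with weights `p i j`. For a prefix, let `L` be the mean load, `Q` the
sum of `p i j ^ 2 * y i j`, and `V` the SDP second moment of the load. Twice the SDP cost is `V +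
Q`; twice the rounded cost is at most `2Q + L²` minus the group saving. Since `Q ≤ V` and `L² ≤ V`,
the factor 3/2 is immediate, and it can be nearly tight only if `Q`, `L²` and `V` nearly agree.
Positive semidefiniteness then forces most of the `y`-mass onto jobs of size close to `L`
(`IsMoment.concentration`). Such jobs occupy two size classes, so groups cover most of them
(`IsGrouping.exists_heavy_groups`), and the group saving beats 3/2 (`IsGrouping.prefix_cost_le`). -/

noncomputable section

variable {M J : Type*}

/-! ### Fractional assignments and pivots -/

/-- A fractional assignment: nonnegative values that add up to one at every job. -/
structure IsFractionalAssignment [Fintype M] (y : M → J → ℝ) : Prop where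
  nonneg : ∀ i j, 0 ≤ y i j
  sum_eq_one : ∀ j, ∑ i, y i j = 1

theorem IsFractionalAssignment.le_one [Fintype M] {y : M → J → ℝ} (hy : IsFractionalAssignment y) (i : M) (j : J) :
    y i j ≤ 1 := by
  rw [← hy.sum_eq_one j]
  exact single_le_sum (f := fun i => y i j) (fun i _ => hy.nonneg i j) (mem_univ i)

/-- The direction in which an iteration of Phase 2 moves the values. -/
def pivotSign [DecidableEq M] [DecidableEq J] (u : M) (v₁ v₂ : J) (u₁ u₂ : M) (i : M) (j : J) : ℝ :=
  (if j = v₁ then (if i = u₁ then 1 else 0) - (if i = u then 1 else 0) else 0) +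
  (if j = v₂ then (if i = u then 1 else 0) - (if i = u₂ then 1 else 0) else 0)

variable {G : M → Finset (Finset J)} {y : M → J → ℝ} {R R' : J → Finset M}
  {u : M} {v₁ v₂ : J} {u₁ u₂ : M}

theorem IsPivot.ne_left (h : IsPivot G y R u v₁ v₂ u₁ u₂) : u₁ ≠ u := by
  rintro rfl; exact h.notMem₁ h.mem₁

theorem IsPivot.ne_right (h : IsPivot G y R u v₁ v₂ u₁ u₂) : u₂ ≠ u := by
  rintro rfl; exact h.notMem₂ h.mem₂

section Sign

variable [DecidableEq M] [DecidableEq J]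

/-- The four edges of a pivot are distinct, so the precedence of the branches in `shiftEdges` is
immaterial and the move is linear in `t`. -/
theorem IsPivot.shiftEdges_eq (h : IsPivot G y R u v₁ v₂ u₁ u₂) (t : ℝ) (i : M) (j : J) :
    shiftEdges y u v₁ v₂ u₁ u₂ t i j = y i j + t * pivotSign u v₁ v₂ u₁ u₂ i j := by
  have h1 := h.ne_left
  have h2 := h.ne_right
  have h3 := h.ne
  unfold shiftEdges pivotSign
  by_cases e1 : j = v₁ <;> by_cases e2 : i = u <;>
    by_cases e3 : i = u₁ <;> by_cases e4 : i = u₂ <;> by_cases e5 : j = v₂ <;>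
    simp_all <;> ring

theorem sum_pivotSign [Fintype M] (j : J) : ∑ i, pivotSign u v₁ v₂ u₁ u₂ i j = 0 := by
  unfold pivotSign
  rw [sum_add_distrib]
  split_ifs <;> simp [sum_sub_distrib]

/-- Edges at one machine and two different jobs never move in the same direction. -/
theorem IsPivot.sign_mul_sign_nonpos (h : IsPivot G y R u v₁ v₂ u₁ u₂) (i : M) {a b : J}
    (hab : a ≠ b) :
    pivotSign u v₁ v₂ u₁ u₂ i a * pivotSign u v₁ v₂ u₁ u₂ i b ≤ 0 := by
  have h1 := h.ne_left
  have h2 := h.ne_right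
  have h3 := h.ne
  unfold pivotSign
  by_cases e1 : a = v₁ <;> by_cases e2 : i = u <;>
    by_cases e3 : i = u₁ <;> by_cases e4 : i = u₂ <;> by_cases e5 : a = v₂ <;>
    by_cases e6 : b = v₁ <;> by_cases e7 : b = v₂ <;> simp_all

/-- Among the edges in `R`, only those at the machine of the pivot move. -/
theorem IsPivot.sign_eq_zero (h : IsPivot G y R u v₁ v₂ u₁ u₂) {i : M} {a : J}
    (hi : i ∈ R a) (hu : i ≠ u) : pivotSign u v₁ v₂ u₁ u₂ i a = 0 := by
  have h1 := h.notMem₁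
  have h2 := h.notMem₂
  unfold pivotSign
  by_cases e1 : a = v₁ <;> by_cases e5 : a = v₂ <;>
    by_cases e3 : i = u₁ <;> by_cases e4 : i = u₂ <;> simp_all

theorem pivotSign_of_ne {i : M} {a : J} (h1 : a ≠ v₁) (h2 : a ≠ v₂) :
    pivotSign u v₁ v₂ u₁ u₂ i a = 0 := by
  simp [pivotSign, h1, h2]

end Sign

theorem IsPivot.stepAlpha_pos (h : IsPivot G y R u v₁ v₂ u₁ u₂) :
    0 < stepAlpha y u v₁ v₂ u₁ u₂ := by
  obtain ⟨⟨_, _⟩, ⟨_, _⟩, ⟨_, _⟩, ⟨_, _⟩⟩ :=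
    And.intro h.floating_uv₁ (And.intro h.floating_uv₂
      (And.intro h.floating_u₁v₁ h.floating_u₂v₂))
  simp only [stepAlpha, lt_min_iff]
  refine ⟨⟨?_, ?_⟩, ?_, ?_⟩ <;> linarith

theorem IsPivot.stepBeta_pos (h : IsPivot G y R u v₁ v₂ u₁ u₂) :
    0 < stepBeta y u v₁ v₂ u₁ u₂ := by
  obtain ⟨⟨_, _⟩, ⟨_, _⟩, ⟨_, _⟩, ⟨_, _⟩⟩ :=
    And.intro h.floating_uv₁ (And.intro h.floating_uv₂
      (And.intro h.floating_u₁v₁ h.floating_u₂v₂))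
  simp only [stepBeta, lt_min_iff]
  refine ⟨⟨?_, ?_⟩, ?_, ?_⟩ <;> linarith

section Shift

variable [Fintype M] [DecidableEq M] [DecidableEq J]

/-- A shift keeps all values nonnegative if it does so on the four edges that it changes. -/
theorem shiftEdges_nonneg (hy : IsFractionalAssignment y) {t : ℝ}
    (h1 : 0 ≤ y u₁ v₁ + t) (h2 : 0 ≤ y u v₂ + t) (h3 : 0 ≤ y u v₁ - t) (h4 : 0 ≤ y u₂ v₂ - t)
    (i : M) (j : J) : 0 ≤ shiftEdges y u v₁ v₂ u₁ u₂ t i j := by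
  unfold shiftEdges
  split_ifs with c1 c2
  · rcases c1 with ⟨rfl, rfl⟩ | ⟨rfl, rfl⟩ <;> assumption
  · rcases c2 with ⟨rfl, rfl⟩ | ⟨rfl, rfl⟩ <;> assumption
  · exact hy.nonneg i j

theorem IsPivot.isFractional_of_nonneg (h : IsPivot G y R u v₁ v₂ u₁ u₂) (hy : IsFractionalAssignment y)
    {t : ℝ} (ht : ∀ i j, 0 ≤ shiftEdges y u v₁ v₂ u₁ u₂ t i j) :
    IsFractionalAssignment (shiftEdges y u v₁ v₂ u₁ u₂ t) := by
  refine ⟨ht, fun j => ?_⟩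
  simp_rw [h.shiftEdges_eq, sum_add_distrib, ← mul_sum, sum_pivotSign, hy.sum_eq_one]
  simp

theorem IsPivot.isFractional_beta (h : IsPivot G y R u v₁ v₂ u₁ u₂) (hy : IsFractionalAssignment y) :
    IsFractionalAssignment (shiftEdges y u v₁ v₂ u₁ u₂ (stepBeta y u v₁ v₂ u₁ u₂)) := by
  -- Unfolding only the right-hand side turns reflexivity into the four bounds by the entries of the
  -- minimum.
  have hb : stepBeta y u v₁ v₂ u₁ u₂ ≤ stepBeta y u v₁ v₂ u₁ u₂ := le_rfl
  have hp := h.stepBeta_pos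
  conv_rhs at hb => unfold stepBeta
  simp only [le_min_iff] at hb
  obtain ⟨⟨_, _⟩, _, _⟩ := hb
  have := hy.nonneg u₁ v₁
  have := hy.nonneg u v₂
  exact h.isFractional_of_nonneg hy
    (shiftEdges_nonneg hy (by linarith) (by linarith) (by linarith) (by linarith))

theorem IsPivot.isFractional_alpha (h : IsPivot G y R u v₁ v₂ u₁ u₂) (hy : IsFractionalAssignment y) :
    IsFractionalAssignment (shiftEdges y u v₁ v₂ u₁ u₂ (-stepAlpha y u v₁ v₂ u₁ u₂)) := by
  have hb : stepAlpha y u v₁ v₂ u₁ u₂ ≤ stepAlpha y u v₁ v₂ u₁ u₂ := le_rfl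
  have hp := h.stepAlpha_pos
  conv_rhs at hb => unfold stepAlpha
  simp only [le_min_iff] at hb
  obtain ⟨⟨_, _⟩, _, _⟩ := hb
  have := hy.nonneg u₂ v₂
  have := hy.nonneg u v₁
  exact h.isFractional_of_nonneg hy
    (shiftEdges_nonneg hy (by linarith) (by linarith) (by linarith) (by linarith))

open Classical in
/-- The number of floating values. -/
def numFloating [Fintype J] (y : M → J → ℝ) : ℕ :=
  #{e : M × J | Floating (y e.1 e.2)}

/-- Only floating edges move, so integral values stay integral, and by `ht` at least one of the four
edges becomes integral. This is the termination measure of Phase 2. -/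
theorem IsPivot.numFloating_lt [Fintype J] (h : IsPivot G y R u v₁ v₂ u₁ u₂) {t : ℝ}
    (ht : y u₁ v₁ + t = 0 ∨ y u₁ v₁ + t = 1 ∨ y u v₂ + t = 0 ∨ y u v₂ + t = 1 ∨
      y u v₁ - t = 0 ∨ y u v₁ - t = 1 ∨ y u₂ v₂ - t = 0 ∨ y u₂ v₂ - t = 1) :
    numFloating (shiftEdges y u v₁ v₂ u₁ u₂ t) < numFloating y := by
  classical
  have n1 := h.ne_left
  have n2 := h.ne_right
  have n3 := h.ne
  have hsub : ∀ e : M × J, Floating (shiftEdges y u v₁ v₂ u₁ u₂ t e.1 e.2) →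
      Floating (y e.1 e.2) := by
    rintro ⟨i, j⟩ he
    dsimp only at he ⊢
    unfold shiftEdges at he
    split_ifs at he with c1 c2
    · rcases c1 with ⟨rfl, rfl⟩ | ⟨rfl, rfl⟩
      exacts [h.floating_u₁v₁, h.floating_uv₂]
    · rcases c2 with ⟨rfl, rfl⟩ | ⟨rfl, rfl⟩
      exacts [h.floating_uv₁, h.floating_u₂v₂]
    · exact he
  have key : ∃ e : M × J, Floating (y e.1 e.2) ∧
      ¬ Floating (shiftEdges y u v₁ v₂ u₁ u₂ t e.1 e.2) := by
    have s1 : shiftEdges y u v₁ v₂ u₁ u₂ t u₁ v₁ = y u₁ v₁ + t := by simp [shiftEdges]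
    have s2 : shiftEdges y u v₁ v₂ u₁ u₂ t u v₂ = y u v₂ + t := by simp [shiftEdges]
    have s3 : shiftEdges y u v₁ v₂ u₁ u₂ t u v₁ = y u v₁ - t := by
      simp [shiftEdges, n1.symm, n3]
    have s4 : shiftEdges y u v₁ v₂ u₁ u₂ t u₂ v₂ = y u₂ v₂ - t := by
      simp [shiftEdges, n2, n3.symm]
    have f0 : ¬ Floating 0 := fun hf => lt_irrefl _ hf.1
    have f1 : ¬ Floating 1 := fun hf => lt_irrefl _ hf.2
    rcases ht with e | e | e | e | e | e | e | e
    · exact ⟨(u₁, v₁), h.floating_u₁v₁, by dsimp only; rwa [s1, e]⟩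
    · exact ⟨(u₁, v₁), h.floating_u₁v₁, by dsimp only; rwa [s1, e]⟩
    · exact ⟨(u, v₂), h.floating_uv₂, by dsimp only; rwa [s2, e]⟩
    · exact ⟨(u, v₂), h.floating_uv₂, by dsimp only; rwa [s2, e]⟩
    · exact ⟨(u, v₁), h.floating_uv₁, by dsimp only; rwa [s3, e]⟩
    · exact ⟨(u, v₁), h.floating_uv₁, by dsimp only; rwa [s3, e]⟩
    · exact ⟨(u₂, v₂), h.floating_u₂v₂, by dsimp only; rwa [s4, e]⟩
    · exact ⟨(u₂, v₂), h.floating_u₂v₂, by dsimp only; rwa [s4, e]⟩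
  obtain ⟨e, he, hne⟩ := key
  refine card_lt_card ⟨fun e he => ?_, fun hs => ?_⟩
  · simp only [mem_filter, mem_univ, true_and] at he ⊢
    exact hsub e he
  · have := hs (mem_filter.2 ⟨mem_univ e, he⟩)
    exact hne (mem_filter.1 this).2

theorem IsPivot.numFloating_beta [Fintype J] (h : IsPivot G y R u v₁ v₂ u₁ u₂) :
    numFloating (shiftEdges y u v₁ v₂ u₁ u₂ (stepBeta y u v₁ v₂ u₁ u₂)) < numFloating y := by
  refine h.numFloating_lt ?_
  unfold stepBeta
  rcases min_choice (min (1 - y u₁ v₁) (y u v₁)) (min (1 - y u v₂) (y u₂ v₂)) with e | e <;>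
    rw [e]
  · rcases min_choice (1 - y u₁ v₁) (y u v₁) with e | e <;> rw [e] <;> simp
  · rcases min_choice (1 - y u v₂) (y u₂ v₂) with e | e <;> rw [e] <;> simp

theorem IsPivot.numFloating_alpha [Fintype J] (h : IsPivot G y R u v₁ v₂ u₁ u₂) :
    numFloating (shiftEdges y u v₁ v₂ u₁ u₂ (-stepAlpha y u v₁ v₂ u₁ u₂)) < numFloating y := by
  refine h.numFloating_lt ?_
  unfold stepAlpha
  rcases min_choice (min (y u₁ v₁) (1 - y u v₁)) (min (y u v₂) (1 - y u₂ v₂)) with e | e <;>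
    rw [e]
  · rcases min_choice (y u₁ v₁) (1 - y u v₁) with e | e <;> rw [e] <;> simp
  · rcases min_choice (y u v₂) (1 - y u₂ v₂) with e | e <;> rw [e] <;> simp

end Shift

theorem exists_isReduction (y : M → J → ℝ) (R : J → Finset M) (v₁ v₂ : J) :
    ∃ R', IsReduction y R v₁ v₂ R' := by
  classical
  have key : ∀ v, ∑ i ∈ R v, y i v = 1 → ∃ i ∈ R v, ∀ i' ∈ R v, y i' v ≤ y i v := by
    intro v hv
    refine exists_max_image (R v) (fun i => y i v) ?_
    rw [nonempty_iff_ne_empty]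
    intro h0
    simp [h0] at hv
  choose f hf hmax using key
  refine ⟨fun v => if h : (v = v₁ ∨ v = v₂) ∧ ∑ i ∈ R v, y i v = 1 then {f v h.2} else R v,
    ?_, ?_, ?_⟩
  · intro v h1 h2
    simp [h1, h2]
  · intro v _ h2
    simp [h2]
  · intro v h1 h2
    exact ⟨f v h2, hf v h2, hmax v h2, by simp [h1, h2]⟩

theorem IsReduction.subset (h : IsReduction y R v₁ v₂ R') (v : J) : R' v ⊆ R v := by
  by_cases hv : v = v₁ ∨ v = v₂
  · by_cases hs : ∑ i ∈ R v, y i v = 1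
    · obtain ⟨i, hi, -, he⟩ := h.reduce v hv hs
      rw [he]; simpa using hi
    · rw [h.keep v hv hs]
  · push Not at hv
    rw [h.other v hv.1 hv.2]

theorem IsReduction.eq_or (h : IsReduction y R v₁ v₂ R') (v : J) :
    R' v = R v ∨ ∑ i ∈ R v, y i v = 1 ∧ ∃ i ∈ R v, R' v = {i} := by
  by_cases hv : v = v₁ ∨ v = v₂
  · by_cases hs : ∑ i ∈ R v, y i v = 1
    · obtain ⟨i, hi, -, he⟩ := h.reduce v hv hs
      exact Or.inr ⟨hs, i, hi, he⟩
    · exact Or.inl (h.keep v hv hs)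
  · push Not at hv
    exact Or.inl (h.other v hv.1 hv.2)

end

noncomputable section

variable {M J : Type*}

/-! ### The algorithm can be run -/

section Laws

variable [Fintype M] [Fintype J] [DecidableEq J]

theorem sum_prod_eq_one {y : M → J → ℝ} (hy : IsFractionalAssignment y) :
    ∑ a : J → M, ∏ v, y (a v) v = 1 := by
  have h := prod_univ_sum (fun _ : J => (univ : Finset M)) (fun v u => y u v)
  rw [Fintype.piFinset_univ] at h
  rw [← h]
  exact prod_eq_one fun v _ => hy.sum_eq_one v

theorem exists_productLaw {y : M → J → ℝ} (hy : IsFractionalAssignment y) :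
    ∃ μ : PMF (J → M), ∀ a, μ a = ENNReal.ofReal (∏ v, y (a v) v) := by
  refine ⟨PMF.ofFintype (fun a => ENNReal.ofReal (∏ v, y (a v) v)) ?_, fun a => rfl⟩
  rw [← ENNReal.ofReal_sum_of_nonneg fun a _ => prod_nonneg fun v _ => hy.nonneg _ _,
    sum_prod_eq_one hy, ENNReal.ofReal_one]

theorem exists_mixture {Ω : Type*} [Fintype Ω] (μ₁ μ₂ : PMF Ω) {α β : ℝ} (hα : 0 < α)
    (hβ : 0 < β) :
    ∃ μ : PMF Ω, ∀ a, μ a =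
      ENNReal.ofReal (α / (α + β)) * μ₁ a + ENNReal.ofReal (β / (α + β)) * μ₂ a := by
  refine ⟨PMF.ofFintype (fun a => ENNReal.ofReal (α / (α + β)) * μ₁ a +
    ENNReal.ofReal (β / (α + β)) * μ₂ a) ?_, fun a => rfl⟩
  have h1 : ∑ a, μ₁ a = 1 := (tsum_fintype _).symm.trans μ₁.tsum_coe
  have h2 : ∑ a, μ₂ a = 1 := (tsum_fintype _).symm.trans μ₂.tsum_coe
  rw [sum_add_distrib, ← mul_sum, ← mul_sum, h1, h2, mul_one, mul_one,
    ← ENNReal.ofReal_add (by positivity) (by positivity), ← add_div,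
    div_self (by positivity), ENNReal.ofReal_one]

theorem exists_isRoundedFrom [DecidableEq M] (G : M → Finset (Finset J)) :
    ∀ (n : ℕ) (y : M → J → ℝ) (R : J → Finset M), numFloating y = n →
      IsFractionalAssignment y → ∃ μ, IsRoundedFrom G y R μ := by
  intro n
  induction n using Nat.strong_induction_on with
  | _ n ih =>
    intro y R hn hy
    by_cases hp : ∃ u v₁ v₂ u₁ u₂, IsPivot G y R u v₁ v₂ u₁ u₂
    · obtain ⟨u, v₁, v₂, u₁, u₂, h⟩ := hp
      obtain ⟨R₁, hR₁⟩ := exists_isReduction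
        (shiftEdges y u v₁ v₂ u₁ u₂ (stepBeta y u v₁ v₂ u₁ u₂)) R v₁ v₂
      obtain ⟨R₂, hR₂⟩ := exists_isReduction
        (shiftEdges y u v₁ v₂ u₁ u₂ (-stepAlpha y u v₁ v₂ u₁ u₂)) R v₁ v₂
      obtain ⟨μ₁, h₁⟩ := ih _ (hn ▸ h.numFloating_beta) _ R₁ rfl (h.isFractional_beta hy)
      obtain ⟨μ₂, h₂⟩ := ih _ (hn ▸ h.numFloating_alpha) _ R₂ rfl (h.isFractional_alpha hy)
      obtain ⟨μ, hμ⟩ := exists_mixture μ₁ μ₂ h.stepAlpha_pos h.stepBeta_pos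
      exact ⟨μ, .step y R u v₁ v₂ u₁ u₂ h _ _ rfl rfl _ _ rfl rfl R₁ R₂ hR₁ hR₂ μ₁ μ₂ μ h₁ h₂ hμ⟩
    · push Not at hp
      obtain ⟨μ, hμ⟩ := exists_productLaw hy
      exact ⟨μ, .finish y R μ hp hμ⟩

end Laws

/-! #### Edge partitions -/

/-- Minimal sets of value at least 1/6 are split off until less than 1/6 remains; that remainder is
the only exceptional part. -/
theorem exists_finpartition_minimal [DecidableEq M] (z : M → ℝ) (S : Finset M) :
    ∃ P : Finpartition S,
      (∀ T ∈ P.parts, 1 / 6 ≤ ∑ u ∈ T, z u →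
        Minimal (fun T : Finset M => 1 / 6 ≤ ∑ u ∈ T, z u) T) ∧
      ∀ T ∈ P.parts, ∀ T' ∈ P.parts, ∑ u ∈ T, z u < 1 / 6 → ∑ u ∈ T', z u < 1 / 6 → T = T' := by
  induction S using Finset.strongInduction with
  | H S ih =>
    by_cases hS : ∑ u ∈ S, z u < 1 / 6
    · by_cases h0 : S = ∅
      · subst h0
        exact ⟨Finpartition.empty _, by simp, by simp⟩
      · refine ⟨Finpartition.indiscrete h0, ?_, ?_⟩
        · intro T hT h
          simp only [Finpartition.indiscrete_parts, mem_singleton] at hT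
          subst hT
          linarith
        · intro T hT T' hT' _ _
          simp only [Finpartition.indiscrete_parts, mem_singleton] at hT hT'
          rw [hT, hT']
    · push Not at hS
      obtain ⟨T, hTS, hT⟩ := exists_minimal_le_of_wellFoundedLT
        (fun T : Finset M => 1 / 6 ≤ ∑ u ∈ T, z u) S hS
      have hne : T ≠ ∅ := by
        rintro rfl
        have := hT.prop
        norm_num at this
      obtain ⟨P, h1, h2⟩ := ih (S \ T)
        (sdiff_ssubset hTS (nonempty_iff_ne_empty.2 hne))
      refine ⟨P.extend (b := T) (c := S) hne sdiff_disjoint (by simpa using hTS), ?_, ?_⟩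
      · intro T' hT' h
        simp only [Finpartition.extend_parts, mem_insert] at hT'
        rcases hT' with rfl | hT'
        exacts [hT, h1 T' hT' h]
      · intro A hA B hB hA' hB'
        have := hT.prop
        simp only [Finpartition.extend_parts, mem_insert] at hA hB
        rcases hA with rfl | hA
        · linarith
        · rcases hB with rfl | hB
          · linarith
          · exact h2 A hA B hB hA' hB'

theorem exists_isEdgePartition [Fintype M] [DecidableEq M] {y : M → J → ℝ}
    (hy : IsFractionalAssignment y) (v : J) :
    ∃ P : Finpartition (univ.filter fun u : M => 0 < y u v), IsEdgePartition y v P := by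
  obtain ⟨P, h1, h2⟩ := exists_finpartition_minimal (fun u => y u v)
    (univ.filter fun u : M => 0 < y u v)
  refine ⟨P, ?_, h1, h2⟩
  have hpos : ∀ T ∈ P.parts, 0 < ∑ u ∈ T, y u v := fun T hT =>
    sum_pos (fun u hu => (mem_filter.1 (P.le hT hu)).2) (P.nonempty_of_mem_parts hT)
  have htot : ∑ T ∈ P.parts, ∑ u ∈ T, y u v ≤ 1 := by
    rw [← hy.sum_eq_one v]
    have := sum_biUnion (s := P.parts) (t := id) (f := fun u => y u v) P.disjoint
    rw [P.biUnion_parts] at this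
    simp only [id] at this
    rw [← this]
    exact sum_le_sum_of_subset_of_nonneg (subset_univ _) fun i _ _ => hy.nonneg i v
  by_cases hsmall : ∃ T ∈ P.parts, ∑ u ∈ T, y u v < 1 / 6
  · obtain ⟨T, hT, hlt⟩ := hsmall
    have hrest : ((#(P.parts.erase T) : ℕ) : ℝ) * (1 / 6) ≤
        ∑ T' ∈ P.parts.erase T, ∑ u ∈ T', y u v := by
      rw [← nsmul_eq_mul]
      refine card_nsmul_le_sum _ _ _ fun T' hT' => ?_
      by_contra! hc
      exact (mem_erase.1 hT').1 (h2 T' (mem_erase.1 hT').2 T hT hc hlt)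
    rw [← add_sum_erase _ _ hT] at htot
    have := hpos T hT
    -- The exceptional part has positive value, so the other parts have total value strictly below 1
    -- and number at most five.
    have h6 : ((#(P.parts.erase T) : ℕ) : ℝ) < 6 := by linarith
    have h6' : #(P.parts.erase T) < 6 := by exact_mod_cast h6
    rw [card_erase_of_mem hT] at h6'
    omega
  · push Not at hsmall
    have := card_nsmul_le_sum _ _ _ hsmall
    rw [nsmul_eq_mul] at this
    have h6 : ((#P.parts : ℕ) : ℝ) ≤ 6 := by linarith
    exact_mod_cast h6

/-! #### Groups -/

theorem exists_greedyGroups [DecidableEq J] (z : J → ℝ) {r : J → ℕ} (hr : Function.Injective r)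
    (S : Finset J) : ∃ 𝒢, GreedyGroups z r S 𝒢 := by
  induction S using Finset.strongInduction with
  | H S ih =>
    by_cases hS : ∑ j ∈ S, z j < 1 / 10
    · exact ⟨∅, .finish S hS⟩
    · push Not at hS
      -- The next group is an inclusion-minimal initial segment of value at least 1/10. Erasing its
      -- last job leaves an initial segment, so minimality gives the `first` condition.
      obtain ⟨T, hTS, hT⟩ := exists_minimal_le_of_wellFoundedLT
        (fun T : Finset J => (∀ j ∈ T, ∀ j' ∈ S \ T, r j < r j') ∧ 1 / 10 ≤ ∑ j ∈ T, z j) S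
        ⟨by simp, hS⟩
      have hne : T.Nonempty := by
        rw [nonempty_iff_ne_empty]
        rintro rfl
        have := hT.prop.2
        norm_num at this
      obtain ⟨𝒢, h𝒢⟩ := ih (S \ T) (sdiff_ssubset hTS hne)
      refine ⟨insert T 𝒢, .pick S T 𝒢 hTS hT.prop.1 hT.prop.2 (fun j hj hmax => ?_) h𝒢⟩
      by_contra! hc
      refine hT.not_prop_of_lt (erase_ssubset hj) ⟨fun i hi j' hj' => ?_, hc⟩
      obtain ⟨hij, hiT⟩ := mem_erase.1 hi
      obtain ⟨hjS, hj'⟩ := mem_sdiff.1 hj'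
      by_cases hjj : j' = j
      · subst hjj
        exact lt_of_le_of_ne (hmax i hiT) (fun e => hij (hr e))
      · exact hT.prop.1 i hiT j' (mem_sdiff.2 ⟨hjS, fun h => hj' (mem_erase.2 ⟨hjj, h⟩)⟩)

theorem exists_isGrouping [Fintype J] [DecidableEq J] (p : M → J → ℝ) (r : M → J → ℕ)
    (hr : ∀ i, Function.Injective (r i)) (y : M → J → ℝ) (i : M) :
    ∃ 𝒢, IsGrouping p r y i 𝒢 := by
  classical
  choose 𝒮 h𝒮 using fun k : ℤ => exists_greedyGroups (y i) (hr i)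
    ((classJobs p y i k).filter fun j => y i j < 1 / 10)
  exact ⟨univ.filter fun S => ∃ k, S ∈ 𝒮 k ∨ ∃ j ∈ classJobs p y i k, 1 / 10 ≤ y i j ∧ S = {j},
    𝒮, h𝒮, fun S => by simp⟩

theorem exists_isAlgorithmOutput [Fintype M] [DecidableEq M] [Fintype J] [DecidableEq J]
    (p : M → J → ℝ) {r : M → J → ℕ} (hr : ∀ i, Function.Injective (r i))
    {x : M → Finset J → ℝ} (hx : IsFractionalAssignment fun i j => x i {j}) :
    ∃ μ, IsAlgorithmOutput p r x μ := by
  choose G hG using exists_isGrouping p r hr fun i j => x i {j}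
  choose P hP using exists_isEdgePartition hx
  choose ρ hρ using fun R => exists_isRoundedFrom G _ (fun i j => x i {j}) R rfl hx
  have hne : (Fintype.piFinset fun v => (P v).parts).Nonempty := by
    rw [Fintype.piFinset_nonempty]
    intro v
    refine (P v).parts_nonempty ?_
    intro h0
    have hz : ∀ u, ¬ 0 < x u {v} := fun u hu => by
      have : u ∈ (univ.filter fun u : M => 0 < x u {v}) := mem_filter.2 ⟨mem_univ _, hu⟩
      rw [h0] at this
      exact absurd this (notMem_empty u)
    have h1 := hx.sum_eq_one v
    rw [sum_eq_zero fun u _ => le_antisymm (not_lt.1 (hz u)) (hx.nonneg u v)] at h1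
    exact zero_ne_one h1
  exact ⟨_, G, hG, P, hP, hne, ρ, fun R _ => hρ R, rfl⟩

end

noncomputable section

variable {M J : Type*}

/-! ### Optimal solutions of the semidefinite program -/

theorem momentMatrix_posSemidef_iff [Fintype J] [DecidableEq J] (x : M → Finset J → ℝ) (i : M) :
    (momentMatrix x i).PosSemidef ↔
      ∀ v : Option J → ℝ, 0 ≤ ∑ s, ∑ t, v s * v t * x i (s.toFinset ∪ t.toFinset) := by
  have hsymm : (momentMatrix x i).IsHermitian := by
    ext s t
    simp [momentMatrix, union_comm]
  have hform : ∀ v : Option J → ℝ, star v ⬝ᵥ (momentMatrix x i).mulVec v =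
      ∑ s, ∑ t, v s * v t * x i (s.toFinset ∪ t.toFinset) := by
    intro v
    simp only [dotProduct, Matrix.mulVec, momentMatrix, Matrix.of_apply, mul_sum]
    refine sum_congr rfl fun s _ => sum_congr rfl fun t _ => ?_
    simp only [Pi.star_apply, star_trivial]
    ring
  rw [Matrix.posSemidef_iff_dotProduct_mulVec]
  simp only [hform, hsymm, true_and]

/-- The semidefinite constraint, with the coordinate of `∅` split off. -/
theorem SDPFeasible.quadratic_nonneg [Fintype M] [Fintype J] [DecidableEq J]
    {x : M → Finset J → ℝ} (hx : SDPFeasible x) (i : M) (b : ℝ) (v : J → ℝ) :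
    0 ≤ b ^ 2 + 2 * b * ∑ j, v j * x i {j} + ∑ j, ∑ j', v j * v j' * x i ({j} ∪ {j'}) := by
  have h := (momentMatrix_posSemidef_iff x i).1 (hx.posSemidef i) (fun s => s.elim b v)
  simp only [Fintype.sum_option, Option.elim, Option.toFinset_none, Option.toFinset_some,
    empty_union, union_empty, hx.empty_eq_one i, sum_add_distrib] at h
  refine h.trans_eq ?_
  have e1 : ∑ j, b * v j * x i {j} = b * ∑ j, v j * x i {j} := by
    rw [mul_sum]; exact sum_congr rfl fun j _ => by ring
  have e2 : ∑ j, v j * b * x i {j} = b * ∑ j, v j * x i {j} := by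
    rw [mul_sum]; exact sum_congr rfl fun j _ => by ring
  rw [e1, e2]
  ring

section Feasible

variable [Fintype M] [Fintype J] [DecidableEq J] {x : M → Finset J → ℝ}

theorem SDPFeasible.single_nonneg (hx : SDPFeasible x) (i : M) (j : J) : 0 ≤ x i {j} := by
  simpa [momentMatrix] using hx.nonneg i none (some j)

theorem SDPFeasible.pair_nonneg (hx : SDPFeasible x) (i : M) (j j' : J) :
    0 ≤ x i ({j} ∪ {j'}) := by
  simpa [momentMatrix] using hx.nonneg i (some j) (some j')

theorem SDPFeasible.isFractionalAssignment (hx : SDPFeasible x) :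
    IsFractionalAssignment fun i j => x i {j} :=
  ⟨hx.single_nonneg, hx.assigned⟩

theorem SDPFeasible.pair_le_one (hx : SDPFeasible x) (i : M) (j j' : J) :
    x i ({j} ∪ {j'}) ≤ 1 := by
  have hj := hx.isFractionalAssignment.le_one i j
  have hj' := hx.isFractionalAssignment.le_one i j'
  by_cases hjj : j = j'
  · subst hjj; simpa using hj
  -- The test vector that is 1 at `j` and -1 at `j'` bounds the pair entry by the mean of the two
  -- diagonal entries.
  have h := hx.quadratic_nonneg i 0 (fun l => (if l = j then 1 else 0) - (if l = j' then 1 else 0))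
  simp only [sub_mul, mul_sub, sum_sub_distrib, ite_mul, mul_ite, one_mul, zero_mul, mul_one,
    mul_zero, sum_ite_eq', mem_univ, if_true, union_self] at h
  rw [union_comm {j'} {j}] at h
  linarith

theorem SDPFeasible.congr {x' : M → Finset J → ℝ} (hx : SDPFeasible x)
    (h : ∀ i s, #s ≤ 2 → x' i s = x i s) : SDPFeasible x' := by
  have hm : ∀ i, momentMatrix x' i = momentMatrix x i := by
    intro i
    ext s t
    refine h i _ ((card_union_le _ _).trans ?_)
    rw [Option.card_toFinset, Option.card_toFinset]
    cases s <;> cases t <;> simp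
  refine ⟨fun j => ?_, fun i => ?_, fun i => ?_, fun i s t => ?_⟩
  · simp_rw [h _ {j} (by simp)]
    exact hx.assigned j
  · rw [hm]; exact hx.posSemidef i
  · rw [h i ∅ (by simp)]; exact hx.empty_eq_one i
  · rw [hm]; exact hx.nonneg i s t

/-- Testing against each fixed vector makes the semidefinite constraint an intersection of closed
half-spaces. -/
theorem isClosed_sdpFeasible : IsClosed {x : M → Finset J → ℝ | SDPFeasible x} := by
  have hset : {x : M → Finset J → ℝ | SDPFeasible x} =
      {x | ∀ j, ∑ i, x i {j} = 1} ∩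
      ({x | ∀ i, ∀ v : Option J → ℝ, 0 ≤ ∑ s, ∑ t, v s * v t * x i (s.toFinset ∪ t.toFinset)} ∩
      ({x | ∀ i, x i ∅ = 1} ∩ {x | ∀ i s t, 0 ≤ momentMatrix x i s t})) := by
    ext x
    simp only [Set.mem_ofPred_eq, Set.mem_inter_iff, ← momentMatrix_posSemidef_iff]
    exact ⟨fun h => ⟨h.assigned, h.posSemidef, h.empty_eq_one, h.nonneg⟩,
      fun h => ⟨h.1, h.2.1, h.2.2.1, h.2.2.2⟩⟩
  have happ : ∀ i (s : Finset J), Continuous fun x : M → Finset J → ℝ => x i s :=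
    fun i s => (continuous_apply s).comp (continuous_apply i)
  rw [hset]
  refine .inter ?_ (.inter ?_ (.inter ?_ ?_))
  · simp only [Set.ofPred_forall]
    exact isClosed_iInter fun j =>
      isClosed_eq (continuous_finsetSum _ fun i _ => happ i {j}) continuous_const
  · simp only [Set.ofPred_forall]
    exact isClosed_iInter fun i => isClosed_iInter fun v => isClosed_le continuous_const
      (continuous_finsetSum _ fun s _ => continuous_finsetSum _ fun t _ =>
        continuous_const.mul (happ i _))
  · simp only [Set.ofPred_forall]
    exact isClosed_iInter fun i => isClosed_eq (happ i ∅) continuous_const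
  · simp only [Set.ofPred_forall]
    exact isClosed_iInter fun i => isClosed_iInter fun s => isClosed_iInter fun t =>
      isClosed_le continuous_const (happ i _)

theorem exists_sdpFeasible [Nonempty M] : ∃ x : M → Finset J → ℝ, SDPFeasible x := by
  classical
  obtain ⟨m⟩ := ‹Nonempty M›
  -- All jobs go to machine `m`; the matrices of the other machines have a single nonzero entry, at
  -- the empty set.
  refine ⟨fun i s => if i = m ∨ s = ∅ then 1 else 0, fun j => ?_, fun i => ?_, fun i => by simp,
    fun i s t => ?_⟩
  · simp
  · rw [momentMatrix_posSemidef_iff]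
    intro v
    by_cases hi : i = m
    · simp only [hi, true_or, if_true, mul_one, ← mul_sum, ← sum_mul]
      exact mul_self_nonneg _
    · simp [hi, Fintype.sum_option, mul_self_nonneg]
  · simp only [momentMatrix, Matrix.of_apply]
    split_ifs <;> norm_num

theorem exists_isSDPOptimal [Nonempty M] (w : J → ℝ) (p : M → J → ℝ) (r : M → J → ℕ) :
    ∃ x : M → Finset J → ℝ, IsSDPOptimal w p r x := by
  -- Coordinates at sets with more than two elements are unconstrained and do not affect the
  -- objective. Setting them to zero makes the feasible set compact without changing the values
  -- attained.
  set K : Set (M → Finset J → ℝ) :=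
    {x | SDPFeasible x} ∩ {x | ∀ i s, 2 < #s → x i s = 0} with hK
  have happ : ∀ i (s : Finset J), Continuous fun x : M → Finset J → ℝ => x i s :=
    fun i s => (continuous_apply s).comp (continuous_apply i)
  have hclosed : IsClosed K := by
    refine isClosed_sdpFeasible.inter ?_
    simp only [Set.ofPred_forall]
    exact isClosed_iInter fun i => isClosed_iInter fun s => isClosed_iInter fun _ =>
      isClosed_eq (happ i s) continuous_const
  have hsub : K ⊆ Set.Icc 0 1 := by
    rintro x ⟨hx, hx0⟩
    have hx : SDPFeasible x := hx
    have : ∀ i s, 0 ≤ x i s ∧ x i s ≤ 1 := by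
      intro i s
      by_cases h : 2 < #s
      · rw [hx0 i s h]; norm_num
      · have h' : #s = 0 ∨ #s = 1 ∨ #s = 2 := by omega
        rcases h' with h | h | h
        · rw [card_eq_zero.1 h, hx.empty_eq_one]; norm_num
        · obtain ⟨j, rfl⟩ := card_eq_one.1 h
          exact ⟨hx.single_nonneg i j, hx.isFractionalAssignment.le_one i j⟩
        · obtain ⟨j, j', -, rfl⟩ := card_eq_two.1 h
          exact ⟨hx.pair_nonneg i j j', hx.pair_le_one i j j'⟩
    exact ⟨fun i s => (this i s).1, fun i s => (this i s).2⟩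
  have hcompact : IsCompact K := isCompact_Icc.of_isClosed_subset hclosed hsub
  have htrunc : ∀ x : M → Finset J → ℝ, SDPFeasible x →
      (fun i s => if 2 < #s then 0 else x i s) ∈ K ∧
      sdpValue w p r (fun i s => if 2 < #s then 0 else x i s) = sdpValue w p r x := by
    intro x hx
    refine ⟨⟨hx.congr fun i s hs => if_neg (by omega), fun i s hs => if_pos hs⟩, ?_⟩
    have h2 : ∀ j j' : J, ¬ 2 < #({j} ∪ {j'} : Finset J) := by
      intro j j'
      have := card_union_le {j} ({j'} : Finset J)
      simp only [card_singleton] at this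
      omega
    simp only [sdpValue, h2, if_false]
  obtain ⟨x₀, hx₀⟩ := exists_sdpFeasible (M := M) (J := J)
  have hcont : Continuous fun x : M → Finset J → ℝ => sdpValue w p r x := by
    unfold sdpValue
    exact continuous_finsetSum _ fun i _ => continuous_finsetSum _ fun j _ =>
      continuous_const.mul (continuous_finsetSum _ fun j' _ => continuous_const.mul (happ i _))
  obtain ⟨x, hxK, hmin⟩ := hcompact.exists_isMinOn ⟨_, (htrunc x₀ hx₀).1⟩ hcont.continuousOn
  refine ⟨x, hxK.1, fun x' hx' => ?_⟩
  rw [← (htrunc x' hx').2]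
  exact hmin (htrunc x' hx').1

end Feasible

end

noncomputable section

variable {M J : Type*}

/-! ### Correlations of the rounding procedure -/

/-- The probability that jobs `a` and `b` are both assigned to machine `u`. -/
def pairProb [Fintype M] [Fintype J] [DecidableEq M] [DecidableEq J] (μ : PMF (J → M)) (u : M)
    (a b : J) : ℝ :=
  ∑ σ : J → M with σ a = u ∧ σ b = u, (μ σ).toReal

/-- The product is over the finset `{a, b}`, so for `a = b` there is a single factor and the formula
gives the marginal. -/
theorem pairProb_of_productLaw [Fintype M] [Fintype J] [DecidableEq M] [DecidableEq J]
    {y : M → J → ℝ} (hy : IsFractionalAssignment y) {μ : PMF (J → M)}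
    (hμ : ∀ a, μ a = ENNReal.ofReal (∏ v, y (a v) v)) (u : M) (a b : J) :
    pairProb μ u a b = ∏ v ∈ {a, b}, y u v := by
  have hset : ({σ : J → M | σ a = u ∧ σ b = u} : Finset (J → M)) =
      Fintype.piFinset fun v => if v = a ∨ v = b then {u} else univ := by
    ext σ
    simp only [mem_filter, mem_univ, true_and, Fintype.mem_piFinset]
    constructor
    · rintro ⟨h1, h2⟩ v
      split_ifs with h
      · rcases h with rfl | rfl <;> simpa
      · exact mem_univ _
    · intro h
      have h1 := h a
      have h2 := h b
      simp only [true_or, or_true, if_true, mem_singleton] at h1 h2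
      exact ⟨h1, h2⟩
  unfold pairProb
  simp_rw [hμ, ENNReal.toReal_ofReal (prod_nonneg fun v _ => hy.nonneg _ v)]
  rw [hset, ← prod_univ_sum (fun v => if v = a ∨ v = b then {u} else univ) (fun v i => y i v),
    ← prod_subset (subset_univ {a, b})]
  · refine prod_congr rfl fun v hv => ?_
    have : v = a ∨ v = b := by simpa using hv
    simp [this]
  · intro v _ hv
    have : ¬ (v = a ∨ v = b) := by simpa using hv
    simp [this, hy.sum_eq_one]

theorem pairProb_of_mixture [Fintype M] [Fintype J] [DecidableEq M] [DecidableEq J]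
    {μ₁ μ₂ μ : PMF (J → M)} {α β : ℝ} (hα : 0 < α) (hβ : 0 < β)
    (law : ∀ a : J → M, μ a =
        ENNReal.ofReal (α / (α + β)) * μ₁ a + ENNReal.ofReal (β / (α + β)) * μ₂ a)
    (u : M) (a b : J) :
    pairProb μ u a b =
      α / (α + β) * pairProb μ₁ u a b + β / (α + β) * pairProb μ₂ u a b := by
  unfold pairProb
  rw [mul_sum, mul_sum, ← sum_add_distrib]
  refine sum_congr rfl fun σ _ => ?_
  rw [law, ENNReal.toReal_add (ENNReal.mul_ne_top ENNReal.ofReal_ne_top (μ₁.apply_ne_top _))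
    (ENNReal.mul_ne_top ENNReal.ofReal_ne_top (μ₂.apply_ne_top _)), ENNReal.toReal_mul,
    ENNReal.toReal_mul, ENNReal.toReal_ofReal (by positivity),
    ENNReal.toReal_ofReal (by positivity)]

/-- The expected value of a concave quadratic after a centered two-point step. -/
theorem mixture_quadratic_le {α β A B C : ℝ} (hα : 0 < α) (hβ : 0 < β) (hC : 0 ≤ C) :
    α / (α + β) * (A + β * B - β ^ 2 * C) + β / (α + β) * (A + -α * B - (-α) ^ 2 * C) ≤ A := by
  have e : α / (α + β) * (A + β * B - β ^ 2 * C) + β / (α + β) * (A + -α * B - (-α) ^ 2 * C) =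
      A - α * β * C := by
    field_simp
    ring
  rw [e]
  have : 0 ≤ α * β * C := by positivity
  linarith

theorem mixture_mono {α β a a' b b' : ℝ} (hα : 0 < α) (hβ : 0 < β) (ha : a ≤ a') (hb : b ≤ b') :
    α / (α + β) * a + β / (α + β) * b ≤ α / (α + β) * a' + β / (α + β) * b' := by
  gcongr

/-! ### Martingale arguments along Phase 2 -/

section Rounding

set_option linter.unusedSectionVars false

variable [Fintype M] [Fintype J] [DecidableEq M] [DecidableEq J] {G : M → Finset (Finset J)}
  {y : M → J → ℝ} {R R' : J → Finset M} {μ : PMF (J → M)}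

theorem IsRoundedFrom.pairProb_self (h : IsRoundedFrom G y R μ) (hy : IsFractionalAssignment y)
    (i : M) (a : J) : pairProb μ i a a = y i a := by
  induction h with
  | finish y R μ final law =>
    rw [pairProb_of_productLaw hy law]
    simp
  | step y R u v₁ v₂ u₁ u₂ pivot α β hα hβ y₁ y₂ hy₁ hy₂ R₁ R₂ hR₁ hR₂ μ₁ μ₂ μ run₁ run₂ law ih₁ ih₂ =>
    have pα : 0 < α := hα ▸ pivot.stepAlpha_pos
    have pβ : 0 < β := hβ ▸ pivot.stepBeta_pos
    rw [pairProb_of_mixture pα pβ law,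
      ih₁ (by rw [hy₁, hβ]; exact pivot.isFractional_beta hy),
      ih₂ (by rw [hy₂, hα]; exact pivot.isFractional_alpha hy), hy₁, hy₂, pivot.shiftEdges_eq,
      pivot.shiftEdges_eq]
    field_simp
    ring

/-- The product of the two values is a supermartingale: along a centered step its quadratic
coefficient is a product of two signs, which is nonpositive. Phase 3 is independent and attains the
product. -/
theorem IsRoundedFrom.pairProb_le (h : IsRoundedFrom G y R μ) (hy : IsFractionalAssignment y)
    (i : M) {a b : J} (hab : a ≠ b) : pairProb μ i a b ≤ y i a * y i b := by
  induction h with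
  | finish y R μ final law =>
    rw [pairProb_of_productLaw hy law, prod_pair hab]
  | step y R u v₁ v₂ u₁ u₂ pivot α β hα hβ y₁ y₂ hy₁ hy₂ R₁ R₂ hR₁ hR₂ μ₁ μ₂ μ run₁ run₂ law ih₁ ih₂ =>
    have pα : 0 < α := hα ▸ pivot.stepAlpha_pos
    have pβ : 0 < β := hβ ▸ pivot.stepBeta_pos
    rw [pairProb_of_mixture pα pβ law]
    have i₁ := ih₁ (by rw [hy₁, hβ]; exact pivot.isFractional_beta hy)
    have i₂ := ih₂ (by rw [hy₂, hα]; exact pivot.isFractional_alpha hy)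
    rw [hy₁, pivot.shiftEdges_eq, pivot.shiftEdges_eq] at i₁
    rw [hy₂, pivot.shiftEdges_eq, pivot.shiftEdges_eq] at i₂
    have hs := pivot.sign_mul_sign_nonpos i hab
    set d := pivotSign u v₁ v₂ u₁ u₂
    refine (mixture_mono pα pβ i₁ i₂).trans (le_trans (le_of_eq ?_)
      (mixture_quadratic_le (A := y i a * y i b) (B := y i a * d i b + y i b * d i a)
      (C := -(d i a * d i b)) pα pβ (by linarith)))
    congr 2 <;> ring

/-- The invariants of Phase 2. -/
structure RoundingInvariant (G : M → Finset (Finset J)) (y : M → J → ℝ) (R : J → Finset M) :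
    Prop where
  fractional : IsFractionalAssignment y
  sum_lt : ∀ v, #(R v) ≤ 1 ∨ ∑ i ∈ R v, y i v < 1
  group_le : ∀ i, ∀ S ∈ G i, #S ≤ 1 ∨ ∑ v ∈ S with i ∈ R v, y i v ≤ 1 / 5

variable {u : M} {v₁ v₂ : J} {u₁ u₂ : M}

theorem IsPivot.sign_of_mem (h : IsPivot G y R u v₁ v₂ u₁ u₂) {i : M} {a : J} (hi : i ∈ R a) :
    pivotSign u v₁ v₂ u₁ u₂ i a =
      if i = u then (if a = v₂ then 1 else 0) - (if a = v₁ then 1 else 0) else 0 := by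
  have h1 := h.notMem₁
  have h2 := h.notMem₂
  have h3 := h.ne
  unfold pivotSign
  by_cases e1 : a = v₁ <;> by_cases e5 : a = v₂ <;> by_cases e2 : i = u <;>
    by_cases e3 : i = u₁ <;> by_cases e4 : i = u₂ <;> simp_all

/-- An iteration of Phase 2 does not change the total value of the edges in `R` in a group. -/
theorem IsPivot.group_sum_eq (h : IsPivot G y R u v₁ v₂ u₁ u₂)
    (hG : ∀ i, (G i : Set (Finset J)).PairwiseDisjoint id) (t : ℝ) {i : M} {S : Finset J}
    (hS : S ∈ G i) :
    ∑ v ∈ S with i ∈ R v, shiftEdges y u v₁ v₂ u₁ u₂ t i v = ∑ v ∈ S with i ∈ R v, y i v := by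
  simp_rw [h.shiftEdges_eq, sum_add_distrib, ← mul_sum]
  suffices hz : ∑ v ∈ S with i ∈ R v, pivotSign u v₁ v₂ u₁ u₂ i v = 0 by rw [hz]; ring
  rw [sum_congr rfl fun v hv => h.sign_of_mem (mem_filter.1 hv).2]
  by_cases hi : i = u
  · subst hi
    obtain ⟨T, hT, h1, h2⟩ := h.same_group
    -- Groups are disjoint, so `S` contains both jobs of the pivot or neither, and the opposite
    -- changes at `u` cancel.
    have hm : v₁ ∈ S ↔ v₂ ∈ S := by
      by_cases hST : S = T
      · subst hST; simp [h1, h2]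
      · have hd := hG i hS hT hST
        simp only [Function.onFun, id] at hd
        exact ⟨fun hv => absurd h1 (disjoint_left.1 hd hv),
          fun hv => absurd h2 (disjoint_left.1 hd hv)⟩
    by_cases hv : v₂ ∈ S <;> simp [sum_sub_distrib, hm, hv, h.mem₁, h.mem₂]
  · simp [hi]

theorem IsPivot.invariant_shift (h : IsPivot G y R u v₁ v₂ u₁ u₂)
    (hG : ∀ i, (G i : Set (Finset J)).PairwiseDisjoint id) (hI : RoundingInvariant G y R) {t : ℝ}
    (ht : IsFractionalAssignment (shiftEdges y u v₁ v₂ u₁ u₂ t))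
    (hR : IsReduction (shiftEdges y u v₁ v₂ u₁ u₂ t) R v₁ v₂ R') :
    RoundingInvariant G (shiftEdges y u v₁ v₂ u₁ u₂ t) R' := by
  refine ⟨ht, fun v => ?_, fun i S hS => ?_⟩
  · by_cases hv : v = v₁ ∨ v = v₂
    · by_cases hs : ∑ i ∈ R v, shiftEdges y u v₁ v₂ u₁ u₂ t i v = 1
      · obtain ⟨i, -, -, he⟩ := hR.reduce v hv hs
        left; simp [he]
      · right
        rw [hR.keep v hv hs]
        refine lt_of_le_of_ne ?_ hs
        rw [← ht.sum_eq_one v]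
        exact sum_le_sum_of_subset_of_nonneg (subset_univ _) fun i _ _ => ht.nonneg i v
    · push Not at hv
      rw [hR.other v hv.1 hv.2]
      have : ∀ i, shiftEdges y u v₁ v₂ u₁ u₂ t i v = y i v := fun i => by
        rw [h.shiftEdges_eq, pivotSign_of_ne hv.1 hv.2, mul_zero, add_zero]
      simp_rw [this]
      exact hI.sum_lt v
  · refine (hI.group_le i S hS).imp_right fun hle => ?_
    rw [← h.group_sum_eq hG t hS] at hle
    refine le_trans (sum_le_sum_of_subset_of_nonneg ?_ fun v _ _ => ht.nonneg i v) hle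
    exact monotone_filter_right S fun v _ hv => hR.subset v hv

theorem RoundingInvariant.le_fifth_of_sum_le (hy : IsFractionalAssignment y) {i : M}
    {S : Finset J} (hle : #S ≤ 1 ∨ ∑ v ∈ S with i ∈ R v, y i v ≤ 1 / 5) {a b : J} (ha : a ∈ S)
    (hb : b ∈ S) (hab : a ≠ b) (hia : i ∈ R a) : y i a ≤ 1 / 5 := by
  rcases hle with hle | hle
  · exact absurd (card_le_one.1 hle a ha b hb) hab
  · exact le_trans (single_le_sum (f := fun v => y i v) (fun v _ => hy.nonneg i v)
      (mem_filter.2 ⟨ha, hia⟩)) hle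

/-- A job with a floating edge in `R` has a floating edge outside of `R`. -/
theorem RoundingInvariant.exists_floating (hI : RoundingInvariant G y R) {i : M} {a : J}
    (hia : i ∈ R a) (hf : Floating (y i a)) : ∃ i' ∉ R a, Floating (y i' a) := by
  have hy := hI.fractional
  have hlt : ∑ i ∈ R a, y i a < 1 := by
    rcases hI.sum_lt a with h | h
    · have : R a = {i} := by
        refine eq_singleton_iff_unique_mem.2 ⟨hia, fun x hx => card_le_one.1 h x hx i hia⟩
      rw [this, sum_singleton]
      exact hf.2
    · exact h
  have hsplit := sum_add_sum_compl (R a) fun i => y i a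
  rw [hy.sum_eq_one a] at hsplit
  obtain ⟨i', hi', hpos⟩ : ∃ i' ∈ (R a)ᶜ, 0 < y i' a := by
    by_contra! hc
    have := sum_nonpos hc
    linarith
  have hi'R : i' ∉ R a := mem_compl.1 hi'
  refine ⟨i', hi'R, hpos, ?_⟩
  have hne : i' ≠ i := by rintro rfl; exact hi'R hia
  have := sum_le_sum_of_subset_of_nonneg (subset_univ {i', i})
    (f := fun i => y i a) fun i _ _ => hy.nonneg i a
  rw [sum_pair hne, hy.sum_eq_one a] at this
  linarith [hf.1]

/-- The potential that bounds the probability of a joint assignment of two jobs of a group. -/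
def pairPotential (y : M → J → ℝ) (R : J → Finset M) (i : M) (a b : J) : ℝ :=
  y i a * y i b * (∑ k ∈ (R a).erase i, y k a + ∑ k ∈ (R b).erase i, y k b)

theorem pairPotential_mono (hy : IsFractionalAssignment y) (hR : ∀ v, R' v ⊆ R v) (i : M)
    (a b : J) : pairPotential y R' i a b ≤ pairPotential y R i a b := by
  unfold pairPotential
  refine mul_le_mul_of_nonneg_left (add_le_add ?_ ?_) (mul_nonneg (hy.nonneg i a) (hy.nonneg i b))
  · exact sum_le_sum_of_subset_of_nonneg (erase_subset_erase i (hR a)) fun k _ _ => hy.nonneg k a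
  · exact sum_le_sum_of_subset_of_nonneg (erase_subset_erase i (hR b)) fun k _ _ => hy.nonneg k b

theorem pairPotential_nonneg (hy : IsFractionalAssignment y) (i : M) (a b : J) :
    0 ≤ pairPotential y R i a b :=
  mul_nonneg (mul_nonneg (hy.nonneg i a) (hy.nonneg i b))
    (add_nonneg (sum_nonneg fun k _ => hy.nonneg k a) (sum_nonneg fun k _ => hy.nonneg k b))

/-- If `i` is the pivot machine, the other edges of `R` stand still and the product is concave along
the step. Otherwise the two edges at `i` stand still and the remaining sum is linear with mean
change zero. -/
theorem IsPivot.mixture_pairPotential_le (h : IsPivot G y R u v₁ v₂ u₁ u₂)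
    (hy : IsFractionalAssignment y) {α β : ℝ} (hα : 0 < α) (hβ : 0 < β) {i : M} {a b : J}
    (hab : a ≠ b) (ha : i ∈ R a) (hb : i ∈ R b) :
    α / (α + β) * pairPotential (shiftEdges y u v₁ v₂ u₁ u₂ β) R i a b +
      β / (α + β) * pairPotential (shiftEdges y u v₁ v₂ u₁ u₂ (-α)) R i a b ≤
    pairPotential y R i a b := by
  unfold pairPotential
  simp_rw [h.shiftEdges_eq]
  have hs := h.sign_mul_sign_nonpos i hab
  by_cases hi : i = u
  · have hz : ∀ c k, k ∈ (R c).erase i → pivotSign u v₁ v₂ u₁ u₂ k c = 0 := fun c k hk =>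
      h.sign_eq_zero (mem_of_mem_erase hk) (hi ▸ ne_of_mem_erase hk)
    have hsum : ∀ (t : ℝ) c, ∑ k ∈ (R c).erase i, (y k c + t * pivotSign u v₁ v₂ u₁ u₂ k c) =
        ∑ k ∈ (R c).erase i, y k c := fun t c => sum_congr rfl fun k hk => by
      rw [hz c k hk, mul_zero, add_zero]
    simp_rw [hsum]
    set s := ∑ k ∈ (R a).erase i, y k a + ∑ k ∈ (R b).erase i, y k b
    have hs0 : 0 ≤ s :=
      add_nonneg (sum_nonneg fun k _ => hy.nonneg k a) (sum_nonneg fun k _ => hy.nonneg k b)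
    set d := pivotSign u v₁ v₂ u₁ u₂
    refine le_trans (le_of_eq ?_) (mixture_quadratic_le (A := y i a * y i b * s)
      (B := (y i a * d i b + y i b * d i a) * s) (C := -(d i a * d i b) * s) hα hβ
      (mul_nonneg (by linarith) hs0))
    congr 2 <;> ring
  · rw [h.sign_eq_zero ha hi, h.sign_eq_zero hb hi]
    simp_rw [sum_add_distrib, ← mul_sum]
    set d := pivotSign u v₁ v₂ u₁ u₂
    refine le_trans (le_of_eq ?_) (mixture_quadratic_le
      (A := y i a * y i b * (∑ k ∈ (R a).erase i, y k a + ∑ k ∈ (R b).erase i, y k b))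
      (B := y i a * y i b * (∑ k ∈ (R a).erase i, d k a + ∑ k ∈ (R b).erase i, d k b))
      (C := 0) hα hβ le_rfl)
    congr 2 <;> ring

/-- Jobs of a common group whose edges are both in `R` are unlikely to be assigned together. -/
theorem IsRoundedFrom.pairProb_le_potential (h : IsRoundedFrom G y R μ)
    (hG : ∀ i, (G i : Set (Finset J)).PairwiseDisjoint id) (hI : RoundingInvariant G y R)
    {i : M} {S : Finset J} (hS : S ∈ G i) {a b : J} (ha : a ∈ S) (hb : b ∈ S) (hab : a ≠ b)
    (hia : i ∈ R a) (hib : i ∈ R b) :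
    pairProb μ i a b ≤ 5 / 4 * pairPotential y R i a b := by
  induction h with
  | finish y R μ final law =>
    have hy := hI.fractional
    have hp := pairPotential_nonneg (R := R) hy i a b
    -- If both values were positive, both would be floating (they are at most 1/5), each job would
    -- have a floating edge outside `R`, and a further pivot would exist.
    suffices hz : y i a * y i b = 0 by
      rw [pairProb_of_productLaw hy law, prod_pair hab, hz]
      linarith
    by_contra hne
    have ha0 : 0 < y i a := (hy.nonneg i a).lt_of_ne' (left_ne_zero_of_mul hne)
    have hb0 : 0 < y i b := (hy.nonneg i b).lt_of_ne' (right_ne_zero_of_mul hne)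
    have ha1 := RoundingInvariant.le_fifth_of_sum_le hy (hI.group_le i S hS) ha hb hab hia
    have hb1 := RoundingInvariant.le_fifth_of_sum_le hy (hI.group_le i S hS) hb ha hab.symm hib
    have hfa : Floating (y i a) := ⟨ha0, by linarith⟩
    have hfb : Floating (y i b) := ⟨hb0, by linarith⟩
    obtain ⟨u₁, hu₁, hf₁⟩ := hI.exists_floating hia hfa
    obtain ⟨u₂, hu₂, hf₂⟩ := hI.exists_floating hib hfb
    exact final i a b u₁ u₂ ⟨hab, hia, hib, ⟨S, hS, ha, hb⟩, hu₁, hu₂, hfa, hfb, hf₁, hf₂⟩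
  | step y R u v₁ v₂ u₁ u₂ pivot α β hα hβ y₁ y₂ hy₁ hy₂ R₁ R₂ hR₁ hR₂ μ₁ μ₂ μ run₁ run₂ law ih₁ ih₂ =>
    have hy := hI.fractional
    have pα : 0 < α := hα ▸ pivot.stepAlpha_pos
    have pβ : 0 < β := hβ ▸ pivot.stepBeta_pos
    have fβ : IsFractionalAssignment (shiftEdges y u v₁ v₂ u₁ u₂ β) := by
      rw [hβ]; exact pivot.isFractional_beta hy
    have fα : IsFractionalAssignment (shiftEdges y u v₁ v₂ u₁ u₂ (-α)) := by
      rw [hα]; exact pivot.isFractional_alpha hy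
    -- If `i` drops out of `R` at one of the jobs, the edges of the old `R` there sum to 1, so those
    -- other than `i` sum to at least 4/5. The bound by the product then suffices, which explains
    -- the factor 5/4. If both edges survive, the potential only decreases as `R` shrinks.
    have key : ∀ (t : ℝ) (R' : J → Finset M) (ν : PMF (J → M)),
        IsFractionalAssignment (shiftEdges y u v₁ v₂ u₁ u₂ t) →
        IsReduction (shiftEdges y u v₁ v₂ u₁ u₂ t) R v₁ v₂ R' →
        IsRoundedFrom G (shiftEdges y u v₁ v₂ u₁ u₂ t) R' ν →
        (RoundingInvariant G (shiftEdges y u v₁ v₂ u₁ u₂ t) R' → i ∈ R' a → i ∈ R' b →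
          pairProb ν i a b ≤ 5 / 4 * pairPotential (shiftEdges y u v₁ v₂ u₁ u₂ t) R' i a b) →
        pairProb ν i a b ≤ 5 / 4 * pairPotential (shiftEdges y u v₁ v₂ u₁ u₂ t) R i a b := by
      intro t R' ν hf hR' hrun ih
      have hle := hI.group_le i S hS
      rw [← pivot.group_sum_eq hG t hS] at hle
      have hIt := pivot.invariant_shift hG hI hf hR'
      set z := shiftEdges y u v₁ v₂ u₁ u₂ t
      have hza := RoundingInvariant.le_fifth_of_sum_le hf hle ha hb hab hia
      have hzb := RoundingInvariant.le_fifth_of_sum_le hf hle hb ha hab.symm hib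
      have hprod := mul_nonneg (hf.nonneg i a) (hf.nonneg i b)
      have hsa : 0 ≤ ∑ k ∈ (R a).erase i, z k a := sum_nonneg fun k _ => hf.nonneg k a
      have hsb : 0 ≤ ∑ k ∈ (R b).erase i, z k b := sum_nonneg fun k _ => hf.nonneg k b
      by_cases hia' : i ∈ R' a
      · by_cases hib' : i ∈ R' b
        · refine (ih hIt hia' hib').trans ?_
          have := pairPotential_mono hf hR'.subset i a b
          linarith
        · have hs : ∑ k ∈ R b, z k b = 1 := by
            rcases hR'.eq_or b with e | ⟨e, -⟩
            · exact absurd hib (e ▸ hib')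
            · exact e
          rw [← add_sum_erase _ _ hib] at hs
          refine (hrun.pairProb_le hf i hab).trans ?_
          unfold pairPotential
          nlinarith
      · have hs : ∑ k ∈ R a, z k a = 1 := by
          rcases hR'.eq_or a with e | ⟨e, -⟩
          · exact absurd hia (e ▸ hia')
          · exact e
        rw [← add_sum_erase _ _ hia] at hs
        refine (hrun.pairProb_le hf i hab).trans ?_
        unfold pairPotential
        nlinarith
    subst hy₁ hy₂
    have k₁ := key β R₁ μ₁ fβ hR₁ run₁ ih₁
    have k₂ := key (-α) R₂ μ₂ fα hR₂ run₂ ih₂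
    rw [pairProb_of_mixture pα pβ law]
    refine (mixture_mono pα pβ k₁ k₂).trans ?_
    have := pivot.mixture_pairPotential_le hy pα pβ hab hia hib
    linarith

end Rounding

end

noncomputable section

variable {M J : Type*}

/-! ### The bipartite rounding procedure -/

/-- All but one of the edges of a part of an edge partition have total value less than `1/6`. -/
theorem IsEdgePartition.sum_erase_lt [Fintype M] [DecidableEq M] {y : M → J → ℝ} {v : J}
    {P : Finpartition (univ.filter fun u : M => 0 < y u v)} (hP : IsEdgePartition y v P)
    (hy : IsFractionalAssignment y) {S : Finset M} (hS : S ∈ P.parts) {u : M} (hu : u ∈ S) :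
    ∑ k ∈ S.erase u, y k v < 1 / 6 := by
  by_cases h : 1 / 6 ≤ ∑ k ∈ S, y k v
  · by_contra! hc
    exact (hP.minimal S hS h).not_prop_of_lt (erase_ssubset hu) hc
  · push Not at h
    exact (sum_le_sum_of_subset_of_nonneg (erase_subset u S) fun k _ _ => hy.nonneg k v).trans_lt h

theorem IsEdgePartition.card_le_one_or_sum_lt [Fintype M] [DecidableEq M] {y : M → J → ℝ} {v : J}
    {P : Finpartition (univ.filter fun u : M => 0 < y u v)} (hP : IsEdgePartition y v P)
    (hy : IsFractionalAssignment y) {S : Finset M} (hS : S ∈ P.parts) :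
    #S ≤ 1 ∨ ∑ k ∈ S, y k v < 1 := by
  by_cases h1 : #S ≤ 1
  · exact Or.inl h1
  · right
    obtain ⟨a, ha, b, hb, hab⟩ := one_lt_card.1 (not_le.1 h1)
    have h2 := hP.sum_erase_lt hy hS ha
    have h3 := hP.sum_erase_lt hy hS hb
    have h4 := single_le_sum (f := fun k => y k v) (fun k _ => hy.nonneg k v)
      (mem_erase.2 ⟨hab, ha⟩)
    rw [← add_sum_erase S (fun k => y k v) ha]
    linarith

variable [Fintype M] [Fintype J] [DecidableEq M] [DecidableEq J] {G : M → Finset (Finset J)}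
  {y : M → J → ℝ} {μ : PMF (J → M)}

theorem pairProb_uniform_bind (Q : Finset (J → Finset M)) (hQ : Q.Nonempty)
    (ρ : (J → Finset M) → PMF (J → M)) (u : M) (a b : J) :
    pairProb ((PMF.uniformOfFinset Q hQ).bind ρ) u a b =
      (#Q : ℝ)⁻¹ * ∑ R ∈ Q, pairProb (ρ R) u a b := by
  unfold pairProb
  rw [sum_comm, mul_sum]
  refine sum_congr rfl fun σ _ => ?_
  rw [PMF.bind_apply, tsum_fintype, ENNReal.toReal_sum fun R _ =>
    ENNReal.mul_ne_top (PMF.apply_ne_top _ _) (PMF.apply_ne_top _ _), mul_sum,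
    ← sum_subset (subset_univ Q)]
  · refine sum_congr rfl fun R hR => ?_
    rw [PMF.uniformOfFinset_apply_of_mem hQ hR, ENNReal.toReal_mul, ENNReal.toReal_inv,
      ENNReal.toReal_natCast]
  · intro R _ hR
    rw [PMF.uniformOfFinset_apply_of_notMem hQ hR, zero_mul, ENNReal.toReal_zero]

/-- Averages of a function on `Q` that is at most `s` everywhere and at most `t` on a part of
density at least `1/36`. -/
theorem average_le {ι : Type*} (Q : Finset ι) (hQ : Q.Nonempty) (F : ι → ℝ) (D : ι → Prop)
    [DecidablePred D] {s t : ℝ} (hts : t ≤ s) (hs : ∀ R ∈ Q, F R ≤ s)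
    (ht : ∀ R ∈ Q, D R → F R ≤ t) (hD : #Q ≤ 36 * #(Q.filter D)) :
    (#Q : ℝ)⁻¹ * ∑ R ∈ Q, F R ≤ s - (s - t) / 36 := by
  have hc : (0 : ℝ) < #Q := by exact_mod_cast card_pos.2 hQ
  have hD' : (#Q : ℝ) ≤ 36 * #(Q.filter D) := by exact_mod_cast hD
  have hle : ∑ R ∈ Q, F R ≤ ∑ R ∈ Q, (s - if D R then s - t else 0) := by
    refine sum_le_sum fun R hR => ?_
    split_ifs with h
    · linarith [ht R hR h]
    · linarith [hs R hR]
  rw [sum_sub_distrib, sum_const, nsmul_eq_mul, ← sum_filter, sum_const, nsmul_eq_mul] at hle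
  rw [inv_mul_le_iff₀ hc]
  nlinarith

/-- The density of the choices of parts that contain prescribed parts at two jobs. -/
theorem card_piFinset_le {κ : Type*} [DecidableEq κ] (P : J → Finset κ) {a b : J} (hab : a ≠ b)
    (ha : #(P a) ≤ 6) (hb : #(P b) ≤ 6) {A B : κ} (hA : A ∈ P a) (hB : B ∈ P b) :
    #(Fintype.piFinset P) ≤ 36 * #((Fintype.piFinset P).filter fun R => R a = A ∧ R b = B) := by
  set T : J → Finset κ := fun v => if v = a then {A} else if v = b then {B} else P v with hT
  have hsub : Fintype.piFinset T ⊆ (Fintype.piFinset P).filter fun R => R a = A ∧ R b = B := by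
    intro R hR
    rw [Fintype.mem_piFinset] at hR
    have hRa : R a = A := by simpa [hT] using hR a
    have hRb : R b = B := by simpa [hT, hab.symm] using hR b
    refine mem_filter.2 ⟨Fintype.mem_piFinset.2 fun v => ?_, hRa, hRb⟩
    by_cases h1 : v = a
    · subst h1; rwa [hRa]
    · by_cases h2 : v = b
      · subst h2; rwa [hRb]
      · simpa [hT, h1, h2] using hR v
  refine le_trans ?_ (Nat.mul_le_mul_left 36 (card_le_card hsub))
  rw [Fintype.card_piFinset, Fintype.card_piFinset]
  -- Fixing the parts at `a` and `b` divides the number of choices by exactly `#(P a) * #(P b)`.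
  have hfac : ∀ v, #(P v) = (if v = a then #(P a) else 1) * ((if v = b then #(P b) else 1) *
      #(T v)) := by
    intro v
    by_cases h1 : v = a
    · subst h1; simp [hT, hab]
    · by_cases h2 : v = b
      · subst h2; simp [hT, h1]
      · simp [hT, h1, h2]
  rw [prod_congr rfl fun v _ => hfac v, prod_mul_distrib, prod_mul_distrib, prod_ite_eq',
    prod_ite_eq']
  simp only [mem_univ, if_true]
  rw [← mul_assoc]
  exact Nat.mul_le_mul_right _ (Nat.mul_le_mul ha hb)

theorem IsBipartiteRounding.pairProb_self (h : IsBipartiteRounding G y μ)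
    (hy : IsFractionalAssignment y) (u : M) (a : J) : pairProb μ u a a = y u a := by
  obtain ⟨P, -, hne, ρ, hρ, rfl⟩ := h
  rw [pairProb_uniform_bind, sum_congr rfl fun R hR => (hρ R hR).pairProb_self hy u a, sum_const,
    nsmul_eq_mul, inv_mul_cancel_left₀]
  exact_mod_cast (card_pos.2 hne).ne'

theorem IsBipartiteRounding.pairProb_le (h : IsBipartiteRounding G y μ)
    (hy : IsFractionalAssignment y) (u : M) {a b : J} (hab : a ≠ b) :
    pairProb μ u a b ≤ y u a * y u b := by
  obtain ⟨P, -, hne, ρ, hρ, rfl⟩ := h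
  have hc : (0 : ℝ) < #(Fintype.piFinset fun v => (P v).parts) := by
    exact_mod_cast card_pos.2 hne
  rw [pairProb_uniform_bind, inv_mul_le_iff₀ hc, ← nsmul_eq_mul]
  exact sum_le_card_nsmul _ _ _ fun R hR => (hρ R hR).pairProb_le hy u hab

/-- Jobs of a common group are assigned together with a probability that is smaller than under
independent rounding by a constant factor. -/
theorem IsBipartiteRounding.pairProb_le_of_group (h : IsBipartiteRounding G y μ)
    (hy : IsFractionalAssignment y) (hG : ∀ i, (G i : Set (Finset J)).PairwiseDisjoint id)
    (hsmall : ∀ i, ∀ S ∈ G i, #S ≤ 1 ∨ ∑ v ∈ S, y i v ≤ 1 / 5) {u : M} {S : Finset J}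
    (hS : S ∈ G u) {a b : J} (ha : a ∈ S) (hb : b ∈ S) (hab : a ≠ b) :
    pairProb μ u a b ≤ (1 - zetaConst) * (y u a * y u b) := by
  have hle := h.pairProb_le hy u hab
  have hab0 : 0 ≤ y u a * y u b := mul_nonneg (hy.nonneg u a) (hy.nonneg u b)
  rcases hab0.eq_or_lt with h0 | hpos
  · rw [← h0] at hle ⊢
    linarith
  have ha0 : 0 < y u a := (hy.nonneg u a).lt_of_ne' (left_ne_zero_of_mul hpos.ne')
  have hb0 : 0 < y u b := (hy.nonneg u b).lt_of_ne' (right_ne_zero_of_mul hpos.ne')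
  obtain ⟨P, hP, hne, ρ, hρ, rfl⟩ := h
  obtain ⟨A, hA, huA⟩ := (P a).exists_mem (mem_filter.2 ⟨mem_univ u, ha0⟩)
  obtain ⟨B, hB, huB⟩ := (P b).exists_mem (mem_filter.2 ⟨mem_univ u, hb0⟩)
  rw [pairProb_uniform_bind]
  -- Each sum over `R` without `u` is initially below 1/6, so the potential bound gives 5/4 · (1/6 +
  -- 1/6) = 5/12. The averaged saving 7/12 · 1/36 = 7/432 exceeds `zetaConst` = 4/432.
  refine (average_le _ hne (fun R => pairProb (ρ R) u a b) (fun R => R a = A ∧ R b = B)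
    (s := y u a * y u b) (t := 5 / 12 * (y u a * y u b)) (by linarith)
    (fun R hR => (hρ R hR).pairProb_le hy u hab) (fun R hR hAB => ?_)
    (card_piFinset_le (fun v => (P v).parts) hab (hP a).card_le (hP b).card_le hA hB)).trans ?_
  · have hRv : ∀ v, R v ∈ (P v).parts := Fintype.mem_piFinset.1 hR
    have hI : RoundingInvariant G y R := by
      refine ⟨hy, fun v => (hP v).card_le_one_or_sum_lt hy (hRv v), fun i T hT => ?_⟩
      refine (hsmall i T hT).imp_right fun hle => le_trans ?_ hle
      exact sum_le_sum_of_subset_of_nonneg (filter_subset _ _) fun v _ _ => hy.nonneg i v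
    obtain ⟨rfl, rfl⟩ := hAB
    refine ((hρ R hR).pairProb_le_potential hG hI hS ha hb hab huA huB).trans ?_
    have h1 := (hP a).sum_erase_lt hy hA huA
    have h2 := (hP b).sum_erase_lt hy hB huB
    unfold pairPotential
    nlinarith
  · unfold zetaConst
    linarith

end

noncomputable section

variable {M J : Type*}

/-! ### Properties of the groups -/

theorem nonempty_of_tenth_le {z : J → ℝ} {T : Finset J} (h : 1 / 10 ≤ ∑ j ∈ T, z j) :
    T.Nonempty := by
  rw [nonempty_iff_ne_empty]
  rintro rfl
  norm_num at h

theorem classJobs_unique [Fintype J] {p y : M → J → ℝ} {i : M} {k k' : ℤ} {j : J}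
    (h : j ∈ classJobs p y i k) (h' : j ∈ classJobs p y i k') : k = k' := by
  simp only [classJobs, mem_filter, mem_univ, true_and] at h h'
  have h1 := (zpow_lt_zpow_iff_right₀ (by norm_num : (1 : ℝ) < 10)).1 (h.2.1.trans_lt h'.2.2)
  have h2 := (zpow_lt_zpow_iff_right₀ (by norm_num : (1 : ℝ) < 10)).1 (h'.2.1.trans_lt h.2.2)
  omega

/-! ### Greedy groups inside one size class -/

section Greedy

variable [DecidableEq J] {z : J → ℝ} {r : J → ℕ} {S : Finset J} {𝒢 : Finset (Finset J)}

theorem GreedyGroups.subset (h : GreedyGroups z r S 𝒢) : ∀ T ∈ 𝒢, T ⊆ S := by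
  induction h with
  | finish S h => simp
  | pick S T 𝒢 sub initial reached first rest ih =>
    intro T' hT'
    rcases mem_insert.1 hT' with rfl | hT'
    exacts [sub, (ih T' hT').trans sdiff_subset]

theorem GreedyGroups.pairwiseDisjoint (h : GreedyGroups z r S 𝒢) :
    (𝒢 : Set (Finset J)).PairwiseDisjoint id := by
  induction h with
  | finish S h => simp
  | pick S T 𝒢 sub initial reached first rest ih =>
    rw [coe_insert]
    refine ih.insert fun T' hT' _ => ?_
    exact disjoint_sdiff.mono_right (rest.subset T' (mem_coe.1 hT'))

theorem GreedyGroups.tenth_le (h : GreedyGroups z r S 𝒢) : ∀ T ∈ 𝒢, 1 / 10 ≤ ∑ j ∈ T, z j := by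
  induction h with
  | finish S h => simp
  | pick S T 𝒢 sub initial reached first rest ih =>
    intro T' hT'
    rcases mem_insert.1 hT' with rfl | hT'
    exacts [reached, ih T' hT']

theorem GreedyGroups.le_fifth (h : GreedyGroups z r S 𝒢) (hz : ∀ j ∈ S, z j < 1 / 10) :
    ∀ T ∈ 𝒢, ∑ j ∈ T, z j ≤ 1 / 5 := by
  induction h with
  | finish S h => simp
  | pick S T 𝒢 sub initial reached first rest ih =>
    intro T' hT'
    rcases mem_insert.1 hT' with rfl | hT'
    · obtain ⟨m, hm, hmax⟩ := exists_max_image T' r (nonempty_of_tenth_le reached)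
      have h1 := first m hm hmax
      have h2 := hz m (sub hm)
      rw [← add_sum_erase _ _ hm]
      linarith
    · exact ih (fun j hj => hz j (sdiff_subset hj)) T' hT'

/-- The jobs of an initial segment that are in no group contained in this segment have total value
less than `1/10`. -/
theorem GreedyGroups.uncovered_lt (h : GreedyGroups z r S 𝒢) (hz : ∀ j, 0 ≤ z j) {A : Finset J}
    (hA : ∀ j ∈ A, ∀ j', r j' ≤ r j → j' ∈ A) :
    ∑ j ∈ (S ∩ A) \ (𝒢.filter (· ⊆ A)).biUnion id, z j < 1 / 10 := by
  induction h with
  | finish S h =>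
    exact (sum_le_sum_of_subset_of_nonneg (sdiff_subset.trans inter_subset_left)
      fun j _ _ => hz j).trans_lt h
  | pick S T 𝒢 sub initial reached first rest ih =>
    by_cases hTA : T ⊆ A
    · refine (sum_le_sum_of_subset_of_nonneg (fun j hj => ?_) fun j _ _ => hz j).trans_lt ih
      simp only [mem_sdiff, mem_inter, mem_biUnion, mem_filter, mem_insert, id] at hj ⊢
      exact ⟨⟨⟨hj.1.1, fun hjT => hj.2 ⟨T, ⟨Or.inl rfl, hTA⟩, hjT⟩⟩, hj.1.2⟩,
        fun ⟨T', hT', hjT'⟩ => hj.2 ⟨T', ⟨Or.inr hT'.1, hT'.2⟩, hjT'⟩⟩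
    -- Here `T` crosses the end of `A`. Jobs of `S` outside `T` come after all of `T`, hence lie
    -- outside `A`, and so does the last job `m` of `T`. What is left of `A` sits in `T.erase m`.
    · obtain ⟨t, htT, htA⟩ := not_subset.1 hTA
      obtain ⟨m, hm, hmax⟩ := exists_max_image T r ⟨t, htT⟩
      refine (sum_le_sum_of_subset_of_nonneg (fun j hj => ?_) fun j _ _ => hz j).trans_lt
        (first m hm hmax)
      obtain ⟨hjS, hjA⟩ := mem_inter.1 (sdiff_subset hj)
      refine mem_erase.2 ⟨?_, ?_⟩
      · rintro rfl
        exact htA (hA j hjA t (hmax t htT))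
      · by_contra hjT
        exact htA (hA j hjA t (initial t htT j (mem_sdiff.2 ⟨hjS, hjT⟩)).le)

end Greedy

/-! ### All groups of a machine -/

section Grouping

variable [Fintype J] [DecidableEq J] {p : M → J → ℝ} {r : M → J → ℕ} {y : M → J → ℝ} {i : M}
  {𝒢 : Finset (Finset J)}

theorem IsGrouping.pairwiseDisjoint (h : IsGrouping p r y i 𝒢) :
    (𝒢 : Set (Finset J)).PairwiseDisjoint id := by
  obtain ⟨𝒮, h𝒮, hG⟩ := h
  intro S hS T hT hST
  simp only [Function.onFun, id]
  rw [disjoint_left]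
  intro j hjS hjT
  obtain ⟨k, hk⟩ := (hG S).1 hS
  obtain ⟨l, hl⟩ := (hG T).1 hT
  rcases hk with hk | ⟨a, ha, ha1, rfl⟩ <;> rcases hl with hl | ⟨b, hb, hb1, rfl⟩
  · have h1 := (h𝒮 k).subset S hk hjS
    have h2 := (h𝒮 l).subset T hl hjT
    obtain rfl := classJobs_unique (mem_filter.1 h1).1 (mem_filter.1 h2).1
    exact disjoint_left.1 ((h𝒮 k).pairwiseDisjoint hk hl hST) hjS hjT
  · obtain rfl := mem_singleton.1 hjT
    have h1 := (h𝒮 k).subset S hk hjS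
    linarith [(mem_filter.1 h1).2]
  · obtain rfl := mem_singleton.1 hjS
    have h2 := (h𝒮 l).subset T hl hjT
    linarith [(mem_filter.1 h2).2]
  · obtain rfl := mem_singleton.1 hjS
    obtain rfl := mem_singleton.1 hjT
    exact hST rfl

theorem IsGrouping.card_le_one_or_sum_le (h : IsGrouping p r y i 𝒢) {S : Finset J} (hS : S ∈ 𝒢) :
    #S ≤ 1 ∨ ∑ j ∈ S, y i j ≤ 1 / 5 := by
  obtain ⟨𝒮, h𝒮, hG⟩ := h
  obtain ⟨k, hk | ⟨j, -, -, rfl⟩⟩ := (hG S).1 hS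
  · exact Or.inr ((h𝒮 k).le_fifth (fun j hj => (mem_filter.1 hj).2) S hk)
  · exact Or.inl (card_singleton j).le

/-- The groups contained in an initial segment `A` of the Smith ordering cover all of the jobs of a
class in `A` except for a set of total value less than `1/10`. -/
theorem IsGrouping.exists_cover (h : IsGrouping p r y i 𝒢) (hy : ∀ j, 0 ≤ y i j) {A : Finset J}
    (hA : ∀ j ∈ A, ∀ j', r i j' ≤ r i j → j' ∈ A) (k : ℤ) :
    ∃ ℋ ⊆ 𝒢, (∀ T ∈ ℋ, T ⊆ classJobs p y i k ∧ T ⊆ A ∧ 1 / 10 ≤ ∑ j ∈ T, y i j) ∧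
      ∑ j ∈ classJobs p y i k ∩ A, y i j < ∑ T ∈ ℋ, ∑ j ∈ T, y i j + 1 / 10 := by
  have hdisj := h.pairwiseDisjoint
  obtain ⟨𝒮, h𝒮, hG⟩ := h
  set C := classJobs p y i k with hC
  set ℋ := 𝒢.filter fun T => T ⊆ C ∧ T ⊆ A ∧ 1 / 10 ≤ ∑ j ∈ T, y i j with hℋ
  refine ⟨ℋ, filter_subset _ _, fun T hT => (mem_filter.1 hT).2, ?_⟩
  have hsum : ∑ T ∈ ℋ, ∑ j ∈ T, y i j = ∑ j ∈ ℋ.biUnion id, y i j := by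
    rw [sum_biUnion (hdisj.subset (coe_subset.2 (filter_subset _ _)))]
    rfl
  have hunc := (h𝒮 k).uncovered_lt hy hA
  rw [hsum]
  have hsub : C ∩ A ⊆ ℋ.biUnion id ∪
      (((C.filter fun j => y i j < 1 / 10) ∩ A) \ ((𝒮 k).filter (· ⊆ A)).biUnion id) := by
    intro j hj
    obtain ⟨hjC, hjA⟩ := mem_inter.1 hj
    rw [mem_union]
    by_cases hlt : y i j < 1 / 10
    · by_cases hcov : j ∈ ((𝒮 k).filter (· ⊆ A)).biUnion id
      · left
        obtain ⟨T, hT, hjT⟩ := mem_biUnion.1 hcov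
        obtain ⟨hT𝒮, hTA⟩ := mem_filter.1 hT
        exact mem_biUnion.2 ⟨T, mem_filter.2 ⟨(hG T).2 ⟨k, Or.inl hT𝒮⟩,
          ((h𝒮 k).subset T hT𝒮).trans (filter_subset _ _), hTA, (h𝒮 k).tenth_le T hT𝒮⟩, hjT⟩
      · right
        exact mem_sdiff.2 ⟨mem_inter.2 ⟨mem_filter.2 ⟨hjC, hlt⟩, hjA⟩, hcov⟩
    · left
      push Not at hlt
      exact mem_biUnion.2 ⟨{j}, mem_filter.2 ⟨(hG {j}).2 ⟨k, Or.inr ⟨j, hjC, hlt, rfl⟩⟩,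
        singleton_subset_iff.2 hjC, singleton_subset_iff.2 hjA, by simpa using hlt⟩,
        mem_singleton_self j⟩
  refine (sum_le_sum_of_subset_of_nonneg hsub fun j _ _ => hy j).trans_lt ?_
  have hui := sum_union_inter (s₁ := ℋ.biUnion id)
    (s₂ := ((C.filter fun j => y i j < 1 / 10) ∩ A) \ ((𝒮 k).filter (· ⊆ A)).biUnion id)
    (f := fun j => y i j)
  have hnn : 0 ≤ ∑ j ∈ ℋ.biUnion id ∩
      (((C.filter fun j => y i j < 1 / 10) ∩ A) \ ((𝒮 k).filter (· ⊆ A)).biUnion id), y i j :=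
    sum_nonneg fun j _ => hy j
  linarith

end Grouping

end

noncomputable section

variable {M J : Type*}

/-! ### Second moments and concentration -/

/-- The quadratic form of a matrix of second moments. -/
def momentForm [Fintype J] (X : J → J → ℝ) (f g : J → ℝ) : ℝ :=
  ∑ j, ∑ j', f j * g j' * X j j'

/-- `y` and `X` behave like the first and second moments of nonnegative `0/1`-variables. -/
structure IsMoment [Fintype J] (X : J → J → ℝ) (y : J → ℝ) : Prop where
  nonneg : ∀ j j', 0 ≤ X j j'
  symm : ∀ j j', X j j' = X j' j
  diag : ∀ j, X j j = y j
  psd : ∀ (b : ℝ) (v : J → ℝ), 0 ≤ b ^ 2 + 2 * b * ∑ j, v j * y j + momentForm X v v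

theorem SDPFeasible.isMoment [Fintype M] [Fintype J] [DecidableEq J] {x : M → Finset J → ℝ}
    (hx : SDPFeasible x) (i : M) :
    IsMoment (fun j j' => x i ({j} ∪ {j'})) (fun j => x i {j}) :=
  ⟨hx.pair_nonneg i, fun j j' => by rw [union_comm], fun j => by rw [union_self],
    hx.quadratic_nonneg i⟩

section Moment

variable [Fintype J] {X : J → J → ℝ} {y e f g : J → ℝ}

theorem momentForm_comm (hX : ∀ j j', X j j' = X j' j) : momentForm X f g = momentForm X g f := by
  unfold momentForm
  rw [sum_comm]
  refine sum_congr rfl fun j _ => sum_congr rfl fun j' _ => ?_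
  rw [hX]; ring

theorem momentForm_add_mul (hX : ∀ j j', X j j' = X j' j) (s : ℝ) :
    momentForm X (fun j => e j + s * f j) (fun j => e j + s * f j) =
      momentForm X e e + 2 * s * momentForm X f e + s ^ 2 * momentForm X f f := by
  have h : momentForm X (fun j => e j + s * f j) (fun j => e j + s * f j) =
      momentForm X e e + s * momentForm X f e + s * momentForm X e f +
        s ^ 2 * momentForm X f f := by
    unfold momentForm
    simp only [mul_sum, ← sum_add_distrib]
    refine sum_congr rfl fun j _ => sum_congr rfl fun j' _ => ?_
    ring
  rw [h, momentForm_comm (f := e) (g := f) hX]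
  ring

theorem momentForm_nonneg (hX : ∀ j j', 0 ≤ X j j') (hf : ∀ j, 0 ≤ f j) (hg : ∀ j, 0 ≤ g j) :
    0 ≤ momentForm X f g :=
  sum_nonneg fun j _ => sum_nonneg fun j' _ => mul_nonneg (mul_nonneg (hf j) (hg j')) (hX j j')

theorem momentForm_mono (hX : ∀ j j', 0 ≤ X j j') (hf : ∀ j, 0 ≤ f j) (hfe : ∀ j, f j ≤ e j) :
    momentForm X f f ≤ momentForm X e e :=
  sum_le_sum fun j _ => sum_le_sum fun j' _ => mul_le_mul_of_nonneg_right
    (mul_le_mul (hfe j) (hfe j') (hf j') ((hf j).trans (hfe j))) (hX j j')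

theorem IsMoment.diag_le_momentForm (hX : IsMoment X y) (hf : ∀ j, 0 ≤ f j) (hg : ∀ j, 0 ≤ g j) :
    ∑ j, f j * g j * y j ≤ momentForm X f g := by
  refine sum_le_sum fun j _ => ?_
  rw [← hX.diag j]
  exact single_le_sum (f := fun j' => f j * g j' * X j j')
    (fun j' _ => mul_nonneg (mul_nonneg (hf j) (hg j')) (hX.nonneg j j')) (mem_univ j)

theorem IsMoment.sq_le_momentForm (hX : IsMoment X y) (e : J → ℝ) :
    (∑ j, e j * y j) ^ 2 ≤ momentForm X e e := by
  have h := hX.psd (-∑ j, e j * y j) e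
  linarith [sq (∑ j, e j * y j)]

/-- If the second moment of the load is close to the square of its mean and to the sum of the
second moments of the jobs, then only jobs of size close to the mean matter. -/
theorem IsMoment.abs_deviation_le (hX : IsMoment X y) (he : ∀ j, 0 ≤ e j) (hf : ∀ j, 0 ≤ f j)
    (hfe : ∀ j, f j ≤ e j) {L Q V : ℝ} (hL : L = ∑ j, e j * y j) (hQ : Q = ∑ j, e j * e j * y j)
    (hV : V = momentForm X e e) (hVQ : V - Q ≤ V / 540000) (hVL : V - L ^ 2 ≤ V / 1080000) :
    |∑ j, f j * e j * y j - L * ∑ j, f j * y j| ≤ V / 1000 := by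
  have hform : ∀ s : ℝ, 0 ≤ V - L ^ 2 + 2 * s * (momentForm X f e - L * ∑ j, f j * y j) +
      s ^ 2 * momentForm X f f := by
    intro s
    -- This perturbs the load `e` in direction `f`: the constant term is the variance `V - L ^ 2`,
    -- and the linear term is the covariance to be bounded.
    have h := hX.psd (-L) (fun j => e j + s * f j)
    rw [momentForm_add_mul hX.symm, ← hV] at h
    have hs : ∑ j, (e j + s * f j) * y j = L + s * ∑ j, f j * y j := by
      rw [hL, mul_sum, ← sum_add_distrib]
      exact sum_congr rfl fun j _ => by ring
    rw [hs] at h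
    linarith
  have hff : momentForm X f f ≤ V := hV ▸ momentForm_mono hX.nonneg hf hfe
  have hV0 : 0 ≤ V := hV ▸ momentForm_nonneg hX.nonneg he he
  have h1 := hX.diag_le_momentForm hf he
  have h2 := hX.diag_le_momentForm (f := fun j => e j - f j) (g := e)
    (fun j => sub_nonneg.2 (hfe j)) he
  have h3 : ∑ j, (e j - f j) * e j * y j = Q - ∑ j, f j * e j * y j := by
    rw [hQ, ← sum_sub_distrib]
    exact sum_congr rfl fun j _ => by ring
  have h4 : momentForm X (fun j => e j - f j) e = V - momentForm X f e := by
    rw [hV]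
    unfold momentForm
    simp only [← sum_sub_distrib]
    exact sum_congr rfl fun j _ => sum_congr rfl fun j' _ => by ring
  rw [h3, h4] at h2
  -- With `s = ±1/1000` the covariance is at most 500 (V - L²) + V/2000. Replacing `momentForm X f
  -- e` by its diagonal costs at most `V - Q`; together this stays below V/1000.
  have p1 := hform (1 / 1000)
  have p2 := hform (-(1 / 1000))
  rw [abs_le]
  constructor <;> linarith

/-- Restricting `e` to small or to large jobs gives sums of `(e j - L) * e j * y j` in which all
factors `e j - L` have one sign and size at least `L/11` or `L/10`. Their smallness therefore leaves
almost all of the load to jobs of medium size. -/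
theorem IsMoment.concentration (hX : IsMoment X y) (hy : ∀ j, 0 ≤ y j) (he : ∀ j, 0 ≤ e j)
    {L Q V : ℝ} (hL : L = ∑ j, e j * y j) (hQ : Q = ∑ j, e j * e j * y j)
    (hV : V = momentForm X e e) (hVQ : V - Q ≤ V / 540000) (hVL : V - L ^ 2 ≤ V / 1080000)
    (hL0 : 0 < L) :
    4 / 5 ≤ ∑ j with 10 / 11 * L < e j ∧ e j < 11 / 10 * L, y j := by
  classical
  have hV0 : 0 ≤ V := hV ▸ momentForm_nonneg hX.nonneg he he
  set s : Finset J := univ.filter fun j => 10 / 11 * L < e j ∧ e j < 11 / 10 * L with hs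
  have hsmall : L * ∑ j with e j ≤ 10 / 11 * L, e j * y j ≤ 11 * (V / 1000) := by
    have h := hX.abs_deviation_le (f := fun j => if e j ≤ 10 / 11 * L then e j else 0) he
      (fun j => by split_ifs; exacts [he j, le_rfl])
      (fun j => by split_ifs; exacts [le_rfl, he j]) hL hQ hV hVQ hVL
    simp only [ite_mul, zero_mul, ← sum_filter] at h
    have h2 : ∑ j with e j ≤ 10 / 11 * L, e j * e j * y j ≤
        10 / 11 * L * ∑ j with e j ≤ 10 / 11 * L, e j * y j := by
      rw [mul_sum]
      refine sum_le_sum fun j hj => ?_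
      rw [mul_assoc]
      exact mul_le_mul_of_nonneg_right (mem_filter.1 hj).2 (mul_nonneg (he j) (hy j))
    have := (abs_le.1 h).1
    linarith
  have hbig : L * ∑ j with 11 / 10 * L ≤ e j, e j * y j ≤ 10 * (V / 1000) := by
    have h := hX.abs_deviation_le (f := fun j => if 11 / 10 * L ≤ e j then e j else 0) he
      (fun j => by split_ifs; exacts [he j, le_rfl])
      (fun j => by split_ifs; exacts [le_rfl, he j]) hL hQ hV hVQ hVL
    simp only [ite_mul, zero_mul, ← sum_filter] at h
    have h2 : 11 / 10 * L * ∑ j with 11 / 10 * L ≤ e j, e j * y j ≤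
        ∑ j with 11 / 10 * L ≤ e j, e j * e j * y j := by
      rw [mul_sum]
      refine sum_le_sum fun j hj => ?_
      rw [mul_assoc (e j)]
      exact mul_le_mul_of_nonneg_right (mem_filter.1 hj).2 (mul_nonneg (he j) (hy j))
    have := (abs_le.1 h).2
    linarith
  have hmid : ∑ j ∈ s, e j * y j ≤ 11 / 10 * L * ∑ j ∈ s, y j := by
    rw [mul_sum]
    exact sum_le_sum fun j hj => mul_le_mul_of_nonneg_right (mem_filter.1 hj).2.2.le (hy j)
  have hsplit : L ≤ ∑ j ∈ s, e j * y j + ∑ j with e j ≤ 10 / 11 * L, e j * y j +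
      ∑ j with 11 / 10 * L ≤ e j, e j * y j := by
    rw [hs, sum_filter, sum_filter, sum_filter, ← sum_add_distrib, ← sum_add_distrib]
    refine hL.trans_le ?_
    refine sum_le_sum fun j _ => ?_
    have h0 := mul_nonneg (he j) (hy j)
    by_cases h1 : e j ≤ 10 / 11 * L
    · rw [if_pos h1]; split_ifs <;> linarith
    · by_cases h2 : 11 / 10 * L ≤ e j
      · rw [if_pos h2]; split_ifs <;> linarith
      · rw [if_pos ⟨not_le.1 h1, not_le.1 h2⟩]; split_ifs; linarith
  have h5 : L * L ≤ L * (11 / 10 * L * ∑ j ∈ s, y j) + 11 * (V / 1000) + 10 * (V / 1000) := by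
    have := mul_le_mul_of_nonneg_left hsplit hL0.le
    have := mul_le_mul_of_nonneg_left hmid hL0.le
    linarith
  have hLL : 0 < L * L := mul_pos hL0 hL0
  have h6 : V ≤ 11 / 10 * (L * L) := by nlinarith
  have h7 : L * L * (4 / 5) ≤ L * L * ∑ j ∈ s, y j := by nlinarith
  exact le_of_mul_le_mul_left h7 hLL

end Moment

end

noncomputable section

variable {M J : Type*}

/-! ### The cost on one machine -/

theorem sum_common_group_le [DecidableEq J] {ℋ : Finset (Finset J)}
    (hd : (ℋ : Set (Finset J)).PairwiseDisjoint id) (j j' : J) :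
    ∑ T ∈ ℋ, ((if j ∈ T then 1 else 0) * (if j' ∈ T then 1 else 0) : ℝ) ≤
      if ∃ T ∈ ℋ, j ∈ T ∧ j' ∈ T then 1 else 0 := by
  split_ifs with h
  · obtain ⟨T, hT, hj, hj'⟩ := h
    rw [sum_eq_single_of_mem T hT]
    · simp [hj, hj']
    · intro S hS hST
      have hjS : j ∉ S := fun hjS => disjoint_left.1 (hd hS hT hST) hjS hj
      simp [hjS]
  · refine sum_nonpos fun T hT => ?_
    by_cases hj : j ∈ T
    · have hj' : j' ∉ T := fun hj' => h ⟨T, hT, hj, hj'⟩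
      simp [hj']
    · simp [hj]

/-- The second moment of the load under a rounding with negative correlations. -/
theorem momentForm_rounding_le [Fintype J] [DecidableEq J] {P : J → J → ℝ} {y e : J → ℝ} {ζ : ℝ}
    (hζ : 0 ≤ ζ) (hζ1 : ζ ≤ 1) (he : ∀ j, 0 ≤ e j) (hy : ∀ j, 0 ≤ y j)
    {ℋ : Finset (Finset J)} (hd : (ℋ : Set (Finset J)).PairwiseDisjoint id)
    (hdiag : ∀ j, P j j = y j) (hP : ∀ j j', j ≠ j' → P j j' ≤ y j * y j')
    (hgroup : ∀ T ∈ ℋ, ∀ j ∈ T, ∀ j' ∈ T, j ≠ j' → P j j' ≤ (1 - ζ) * (y j * y j')) :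
    momentForm P e e ≤ ∑ j, e j * e j * y j + (∑ j, e j * y j) ^ 2 -
      ζ * ∑ T ∈ ℋ, (∑ j ∈ T, e j * y j) ^ 2 := by
  have hpt : ∀ j j', P j j' ≤ (if j = j' then y j else 0) + y j * y j' -
      ζ * ((y j * y j') * ∑ T ∈ ℋ, ((if j ∈ T then 1 else 0) * (if j' ∈ T then 1 else 0))) := by
    intro j j'
    have hyy := mul_nonneg (hy j) (hy j')
    have hc := sum_common_group_le hd j j'
    by_cases h : ∃ T ∈ ℋ, j ∈ T ∧ j' ∈ T
    · rw [if_pos h] at hc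
      have h1 := mul_le_mul_of_nonneg_left (mul_le_mul_of_nonneg_left hc hyy) hζ
      -- The squares of group sums contain diagonal terms although rounding saves nothing there.
      -- They are paid by the term `y j * y j`, which the diagonal does not need, since `ζ ≤ 1`.
      by_cases hj : j = j'
      · subst hj
        rw [if_pos rfl, hdiag]
        nlinarith
      · obtain ⟨T, hT, h2, h3⟩ := h
        have := hgroup T hT j h2 j' h3 hj
        rw [if_neg hj]
        linarith
    · rw [if_neg h] at hc
      have h1 := mul_le_mul_of_nonneg_left (mul_le_mul_of_nonneg_left hc hyy) hζ
      by_cases hj : j = j'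
      · subst hj
        rw [if_pos rfl, hdiag]
        linarith
      · have := hP j j' hj
        rw [if_neg hj]
        linarith
  have hle : momentForm P e e ≤ ∑ j, ∑ j', e j * e j' * ((if j = j' then y j else 0) + y j * y j' -
      ζ * ((y j * y j') * ∑ T ∈ ℋ, ((if j ∈ T then 1 else 0) * (if j' ∈ T then 1 else 0)))) :=
    sum_le_sum fun j _ => sum_le_sum fun j' _ =>
      mul_le_mul_of_nonneg_left (hpt j j') (mul_nonneg (he j) (he j'))
  refine hle.trans_eq ?_
  have hT : ∀ T ∈ ℋ, (∑ j ∈ T, e j * y j) ^ 2 =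
      ∑ j, ∑ j', e j * e j' * (y j * y j') *
        ((if j ∈ T then 1 else 0) * (if j' ∈ T then 1 else 0)) := by
    intro T _
    have h1 : ∑ j ∈ T, e j * y j = ∑ j, (if j ∈ T then 1 else 0) * (e j * y j) := by
      simp
    rw [h1, sq, sum_mul_sum]
    exact sum_congr rfl fun j _ => sum_congr rfl fun j' _ => by ring
  have h2 : ∑ T ∈ ℋ, (∑ j ∈ T, e j * y j) ^ 2 = ∑ j, ∑ j', e j * e j' * ((y j * y j') *
      ∑ T ∈ ℋ, ((if j ∈ T then 1 else 0) * (if j' ∈ T then 1 else 0))) := by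
    rw [sum_congr rfl hT, sum_comm]
    refine sum_congr rfl fun j _ => ?_
    rw [sum_comm]
    refine sum_congr rfl fun j' _ => ?_
    rw [← mul_sum, mul_assoc]
  have h3 : (∑ j, e j * y j) ^ 2 = ∑ j, ∑ j', e j * e j' * (y j * y j') := by
    rw [sq, sum_mul_sum]
    exact sum_congr rfl fun j _ => sum_congr rfl fun j' _ => by ring
  have h4 : ∑ j, e j * e j * y j = ∑ j, ∑ j', e j * e j' * (if j = j' then y j else 0) := by
    refine sum_congr rfl fun j _ => ?_
    simp
  rw [h2, h3, h4, mul_sum, ← sum_add_distrib, ← sum_sub_distrib]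
  refine sum_congr rfl fun j _ => ?_
  rw [mul_sum, ← sum_add_distrib, ← sum_sub_distrib]
  exact sum_congr rfl fun j' _ => by ring

/-- Sums over ordered pairs of jobs of an initial segment. -/
theorem sum_prefix_eq [Fintype J] [DecidableEq J] {r : J → ℕ} (hr : Function.Injective r)
    {q : J → ℝ} {F : J → J → ℝ} (hF : ∀ j j', F j j' = F j' j) {A : Finset J}
    (hA : ∀ j ∈ A, ∀ j', r j' ≤ r j → j' ∈ A) :
    2 * ∑ j ∈ A, q j * ∑ j' with r j' ≤ r j, q j' * F j j' =
      momentForm F (fun j => if j ∈ A then q j else 0) (fun j => if j ∈ A then q j else 0) +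
        ∑ j ∈ A, q j * q j * F j j := by
  have hin : ∑ j ∈ A, q j * ∑ j' with r j' ≤ r j, q j' * F j j' =
      ∑ j ∈ A, ∑ j' ∈ A, if r j' ≤ r j then q j * q j' * F j j' else 0 := by
    refine sum_congr rfl fun j hj => ?_
    rw [mul_sum, ← sum_filter]
    refine sum_congr ?_ fun j' _ => by ring
    ext j'
    simp only [mem_filter, mem_univ, true_and]
    exact ⟨fun h => ⟨hA j hj j' h, h⟩, fun h => h.2⟩
  -- Adding the sum to its transpose counts each off-diagonal ordered pair once and the diagonal
  -- twice.
  have hswap : ∑ j ∈ A, ∑ j' ∈ A, (if r j' ≤ r j then q j * q j' * F j j' else 0) =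
      ∑ j ∈ A, ∑ j' ∈ A, if r j ≤ r j' then q j * q j' * F j j' else 0 := by
    rw [sum_comm]
    refine sum_congr rfl fun j _ => sum_congr rfl fun j' _ => ?_
    rw [hF j' j, mul_comm (q j') (q j)]
  have hform : momentForm F (fun j => if j ∈ A then q j else 0)
      (fun j => if j ∈ A then q j else 0) = ∑ j ∈ A, ∑ j' ∈ A, q j * q j' * F j j' := by
    unfold momentForm
    simp [sum_ite_mem, ite_mul, mul_ite]
  have hdiag : ∑ j ∈ A, q j * q j * F j j =
      ∑ j ∈ A, ∑ j' ∈ A, if j = j' then q j * q j' * F j j' else 0 := by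
    refine sum_congr rfl fun j hj => ?_
    simp [hj]
  rw [two_mul]
  nth_rewrite 2 [hin]
  rw [hin, hswap]
  nth_rewrite 1 [← hswap]
  rw [hform, hdiag, ← sum_add_distrib, ← sum_add_distrib]
  refine sum_congr rfl fun j _ => ?_
  rw [← sum_add_distrib, ← sum_add_distrib]
  refine sum_congr rfl fun j' _ => ?_
  by_cases h : j = j'
  · subst h; simp
  · have hne : r j ≠ r j' := fun e => h (hr e)
    rcases lt_or_gt_of_ne hne with h1 | h1
    · simp [h, h1.le, h1.not_ge]
    · simp [h, h1.le, h1.not_ge]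

/-! ### Prefixes of the Smith order with weights `p i j` -/

section Machine

variable [Fintype J] [DecidableEq J] {p : M → J → ℝ} {r : M → J → ℕ} {y : M → J → ℝ} {i : M}
  {𝒢 : Finset (Finset J)} {X : J → J → ℝ}

/-- Concentrated loads leave much weight in groups. -/
theorem IsGrouping.exists_heavy_groups (h : IsGrouping p r y i 𝒢) (hy : ∀ j, 0 ≤ y i j)
    {A : Finset J} (hA : ∀ j ∈ A, ∀ j', r i j' ≤ r i j → j' ∈ A) {L : ℝ} (hL : 0 < L)
    (hmass : 4 / 5 ≤ ∑ j ∈ A with 10 / 11 * L < p i j ∧ p i j < 11 / 10 * L, y i j) :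
    ∃ ℋ ⊆ 𝒢, (∀ T ∈ ℋ, T ⊆ A) ∧ L ^ 2 / 5000 ≤ ∑ T ∈ ℋ, (∑ j ∈ T, p i j * y i j) ^ 2 := by
  -- The size window has ratio 121/100 < 10, so it meets only the class `n + 1`, which contains `10
  -- / 11 * L`, and the next one. All sizes in these classes are at least `L / 11`.
  obtain ⟨n, hn1, hn2⟩ := exists_mem_Ico_zpow (x := 10 / 11 * L) (y := (10 : ℝ)) (by positivity)
    (by norm_num)
  obtain ⟨ℋ₁, hs₁, ht₁, hc₁⟩ := h.exists_cover hy hA (n + 1)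
  obtain ⟨ℋ₂, hs₂, ht₂, hc₂⟩ := h.exists_cover hy hA (n + 2)
  have e1 : (10 : ℝ) ^ (n + 1) = 10 ^ n * 10 := zpow_add_one₀ (by norm_num) n
  have e2 : (10 : ℝ) ^ (n + 2) = 10 ^ n * 100 := by
    rw [zpow_add₀ (by norm_num)]; norm_num
  have hpn : 0 < (10 : ℝ) ^ n := by positivity
  have hdisj : Disjoint ℋ₁ ℋ₂ := by
    rw [disjoint_left]
    intro T hT₁ hT₂
    obtain ⟨j, hj⟩ := nonempty_of_tenth_le (ht₁ T hT₁).2.2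
    have := classJobs_unique ((ht₁ T hT₁).1 hj) ((ht₂ T hT₂).1 hj)
    omega
  -- One of the two factors of the squared group value is bounded below by 1/10: (L/11)² · 1/10 =
  -- L²/1210.
  have hbound : ∀ T ∈ ℋ₁ ∪ ℋ₂, L ^ 2 / 1210 * ∑ j ∈ T, y i j ≤ (∑ j ∈ T, p i j * y i j) ^ 2 := by
    intro T hT
    have hpT : ∀ j ∈ T, L / 11 ≤ p i j := by
      intro j hj
      rcases mem_union.1 hT with hT | hT
      · have := (mem_filter.1 ((ht₁ T hT).1 hj)).2.2.1
        rw [show n + 1 - 1 = n by ring] at this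
        linarith
      · have := (mem_filter.1 ((ht₂ T hT).1 hj)).2.2.1
        rw [show n + 2 - 1 = n + 1 by ring] at this
        linarith
    have hyT : 1 / 10 ≤ ∑ j ∈ T, y i j := by
      rcases mem_union.1 hT with hT | hT
      exacts [(ht₁ T hT).2.2, (ht₂ T hT).2.2]
    have hsum : L / 11 * ∑ j ∈ T, y i j ≤ ∑ j ∈ T, p i j * y i j := by
      rw [mul_sum]
      exact sum_le_sum fun j hj => mul_le_mul_of_nonneg_right (hpT j hj) (hy j)
    have hsq := pow_le_pow_left₀ (by positivity) hsum 2
    refine le_trans ?_ hsq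
    have := mul_le_mul_of_nonneg_left hyT
      (mul_nonneg (by positivity : 0 ≤ L ^ 2 / 121) (by linarith : 0 ≤ ∑ j ∈ T, y i j))
    nlinarith
  refine ⟨ℋ₁ ∪ ℋ₂, union_subset hs₁ hs₂, fun T hT => ?_, ?_⟩
  · rcases mem_union.1 hT with hT | hT
    exacts [(ht₁ T hT).2.1, (ht₂ T hT).2.1]
  · have hle := sum_le_sum hbound
    rw [← mul_sum, sum_union hdisj] at hle
    have hcov : ∑ j ∈ A with 10 / 11 * L < p i j ∧ p i j < 11 / 10 * L, y i j ≤
        ∑ j ∈ classJobs p y i (n + 1) ∩ A, y i j + ∑ j ∈ classJobs p y i (n + 2) ∩ A, y i j := by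
      have hui := sum_union_inter (s₁ := classJobs p y i (n + 1) ∩ A)
        (s₂ := classJobs p y i (n + 2) ∩ A) (f := fun j => y i j)
      have hnn : 0 ≤ ∑ j ∈ (classJobs p y i (n + 1) ∩ A) ∩ (classJobs p y i (n + 2) ∩ A), y i j :=
        sum_nonneg fun j _ => hy j
      rw [← sum_filter_of_ne (p := fun j => 0 < y i j) fun j _ hj => (hy j).lt_of_ne' hj]
      refine le_trans (sum_le_sum_of_subset_of_nonneg (t := (classJobs p y i (n + 1) ∩ A) ∪
        (classJobs p y i (n + 2) ∩ A)) (fun j hj => ?_) fun j _ _ => hy j) (by linarith)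
      simp only [mem_filter] at hj
      obtain ⟨⟨hjA, h1, h2⟩, h3⟩ := hj
      simp only [classJobs, mem_union, mem_inter, mem_filter, mem_univ, true_and,
        show n + 1 - 1 = n by ring, show n + 2 - 1 = n + 1 by ring]
      rcases lt_or_ge (p i j) (10 ^ (n + 1)) with hlt | hge
      · exact Or.inl ⟨⟨h3, by linarith, hlt⟩, hjA⟩
      · exact Or.inr ⟨⟨h3, hge, by linarith⟩, hjA⟩
    -- Each of the two classes loses less than 1/10 of the mass 4/5.
    have hm : 3 / 5 ≤ ∑ T ∈ ℋ₁, ∑ j ∈ T, y i j + ∑ T ∈ ℋ₂, ∑ j ∈ T, y i j := by linarith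
    have := mul_le_mul_of_nonneg_left hm (by positivity : 0 ≤ L ^ 2 / 1210)
    have : 0 ≤ L ^ 2 := by positivity
    linarith

/-- The bound for an initial segment of the Smith ordering, with weights equal to processing
times. -/
theorem IsGrouping.prefix_cost_le (h : IsGrouping p r y i 𝒢) (hr : Function.Injective (r i))
    (hp : ∀ j, 0 ≤ p i j) (hX : IsMoment X (y i)) (hy : ∀ j, 0 ≤ y i j) {P : J → J → ℝ}
    (hsymm : ∀ j j', P j j' = P j' j) (hdiag : ∀ j, P j j = y i j)
    (hP : ∀ j j', j ≠ j' → P j j' ≤ y i j * y i j')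
    (hgroup : ∀ T ∈ 𝒢, ∀ j ∈ T, ∀ j' ∈ T, j ≠ j' →
      P j j' ≤ (1 - zetaConst) * (y i j * y i j'))
    {A : Finset J} (hA : ∀ j ∈ A, ∀ j', r i j' ≤ r i j → j' ∈ A) :
    ∑ j ∈ A, p i j * ∑ j' with r i j' ≤ r i j, p i j' * P j j' ≤
      (3 / 2 - zetaConst / 20000) *
        ∑ j ∈ A, p i j * ∑ j' with r i j' ≤ r i j, p i j' * X j j' := by
  have h1 := sum_prefix_eq hr (q := p i) hsymm hA
  have h2 := sum_prefix_eq hr (q := p i) hX.symm hA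
  set e : J → ℝ := fun j => if j ∈ A then p i j else 0 with he
  have he0 : ∀ j, 0 ≤ e j := fun j => by
    simp only [he]
    split_ifs
    exacts [hp j, le_rfl]
  have hQA : ∑ j ∈ A, p i j * p i j * y i j = ∑ j, e j * e j * y i j := by
    simp [he, sum_ite_mem, ite_mul, mul_ite]
  simp only [hdiag] at h1
  simp only [hX.diag] at h2
  rw [hQA] at h1 h2
  obtain ⟨Q, hQ⟩ : ∃ Q, Q = ∑ j, e j * e j * y i j := ⟨_, rfl⟩
  obtain ⟨L, hL⟩ : ∃ L, L = ∑ j, e j * y i j := ⟨_, rfl⟩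
  obtain ⟨V, hV⟩ : ∃ V, V = momentForm X e e := ⟨_, rfl⟩
  have hQV : Q ≤ V := by rw [hQ, hV]; exact hX.diag_le_momentForm he0 he0
  have hLV : L ^ 2 ≤ V := by rw [hL, hV]; exact hX.sq_le_momentForm e
  have hL0 : 0 ≤ L := hL ▸ sum_nonneg fun j _ => mul_nonneg (he0 j) (hy j)
  have hQ0 : 0 ≤ Q := hQ ▸ sum_nonneg fun j _ => mul_nonneg (mul_nonneg (he0 j) (he0 j)) (hy j)
  have key : ∀ ℋ ⊆ 𝒢, momentForm P e e ≤ Q + L ^ 2 -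
      zetaConst * ∑ T ∈ ℋ, (∑ j ∈ T, e j * y i j) ^ 2 := by
    intro ℋ hℋ
    rw [hQ, hL]
    exact momentForm_rounding_le (by norm_num [zetaConst]) (by norm_num [zetaConst]) he0 hy
      (h.pairwiseDisjoint.subset (coe_subset.2 hℋ)) hdiag hP fun T hT => hgroup T (hℋ hT)
  rw [← hQ] at h1 h2
  rw [← hV] at h2
  suffices hs : momentForm P e e + Q ≤ (3 / 2 - zetaConst / 20000) * (V + Q) by
    rw [← h1, ← h2] at hs
    linarith
  by_contra! hc
  have k0 := key ∅ (empty_subset _)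
  rw [sum_empty, mul_zero, sub_zero] at k0
  have hz : zetaConst / 20000 = 1 / 2160000 := by norm_num [zetaConst]
  -- Without any group saving, the failed inequality reads (V - L²) + (V - Q)/2 < (V + Q)/2160000,
  -- and the right-hand side is at most V/1080000.
  have hVQ : V - Q ≤ V / 540000 := by rw [hz] at hc; linarith
  have hVL : V - L ^ 2 ≤ V / 1080000 := by rw [hz] at hc; linarith
  have hVpos : 0 < V := by
    by_contra! hV0
    have : V = 0 := le_antisymm hV0 (hQ0.trans hQV)
    have : Q = 0 := le_antisymm (this ▸ hQV) hQ0
    nlinarith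
  have hLpos : 0 < L := by
    refine hL0.lt_of_ne ?_
    rintro h0
    rw [← h0] at hVL
    linarith
  have hconc := hX.concentration hy he0 hL hQ hV hVQ hVL hLpos
  have hset : (univ.filter fun j => 10 / 11 * L < e j ∧ e j < 11 / 10 * L) =
      A.filter fun j => 10 / 11 * L < p i j ∧ p i j < 11 / 10 * L := by
    ext j
    simp only [mem_filter, mem_univ, true_and, he]
    by_cases hj : j ∈ A
    · simp [hj]
    · simp only [hj, if_false, false_and, iff_false, not_and, not_lt]
      intro h0
      linarith
  rw [hset] at hconc
  obtain ⟨ℋ, hℋ, hℋA, hheavy⟩ := h.exists_heavy_groups hy hA hLpos hconc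
  have hsum : ∑ T ∈ ℋ, (∑ j ∈ T, e j * y i j) ^ 2 = ∑ T ∈ ℋ, (∑ j ∈ T, p i j * y i j) ^ 2 := by
    refine sum_congr rfl fun T hT => ?_
    congr 1
    refine sum_congr rfl fun j hj => ?_
    simp only [he, if_pos (hℋA T hT hj)]
  -- The group saving is at least `zetaConst * L ^ 2 / 5000`, with `L ^ 2` almost `V`, whereas the
  -- failed inequality leaves room for at most `zetaConst * V / 10000`.
  have k1 := key ℋ hℋ
  rw [hsum] at k1
  have hz' : zetaConst = 1 / 108 := rfl
  rw [hz'] at k1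
  rw [hz] at hc
  linarith

end Machine

/-- Abel summation: nonnegative partial sums stay nonnegative under decreasing weights. -/
theorem sum_mul_nonneg_of_antitone [DecidableEq J] {r : J → ℕ} {θ f : J → ℝ} (A : Finset J)
    (hθ : ∀ j ∈ A, ∀ j' ∈ A, r j' < r j → θ j ≤ θ j')
    (hf : ∀ n, 0 ≤ ∑ j ∈ A with r j ≤ n, f j) (hr : Function.Injective r) {t : ℝ} (ht0 : 0 ≤ t)
    (ht : ∀ j ∈ A, t ≤ θ j) : t * ∑ j ∈ A, f j ≤ ∑ j ∈ A, θ j * f j := by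
  induction A using Finset.induction_on_max_value r generalizing t with
  | empty => simp
  | insert a s ha hmax ih =>
    have hlt : ∀ j ∈ s, r j < r a := fun j hj =>
      lt_of_le_of_ne (hmax j hj) fun e => ha (hr e ▸ hj)
    have hpre : ∀ n, 0 ≤ ∑ j ∈ s with r j ≤ n, f j := by
      intro n
      rcases lt_or_ge n (r a) with hn | hn
      · have := hf n
        rwa [filter_insert, if_neg (not_le.2 hn)] at this
      · rcases s.eq_empty_or_nonempty with rfl | hs
        · simp
        · obtain ⟨m, hm, hmm⟩ := exists_max_image s r hs
          have := hf (r m)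
          rw [filter_insert, if_neg (not_le.2 (hlt m hm)), filter_true_of_mem hmm] at this
          rwa [filter_true_of_mem fun j hj => (hlt j hj).le.trans hn]
    have hall : 0 ≤ ∑ j ∈ insert a s, f j := by
      have := hf (r a)
      rwa [filter_true_of_mem] at this
      intro j hj
      rcases mem_insert.1 hj with rfl | hj
      exacts [le_rfl, hmax j hj]
    -- The last element `a` has the smallest weight, so `θ a` serves as the lower bound for the
    -- earlier elements. The full sum is then at least `θ a` times the total, hence at least `t`
    -- times it.
    have hi := ih (t := θ a) (fun j hj j' hj' => hθ j (mem_insert_of_mem hj) j'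
      (mem_insert_of_mem hj')) hpre (ht0.trans (ht a (mem_insert_self a s)))
      (fun j hj => hθ a (mem_insert_self a s) j (mem_insert_of_mem hj) (hlt j hj))
    have hta := mul_le_mul_of_nonneg_right (ht a (mem_insert_self a s)) hall
    rw [sum_insert ha] at hta ⊢
    rw [sum_insert ha]
    linarith

end

/-! ### Arbitrary weights and the expected cost -/

noncomputable section

variable {M J : Type*}

/-- The bound for one machine. -/
theorem IsGrouping.machine_cost_le [Fintype J] [DecidableEq J] {w : J → ℝ} {p : M → J → ℝ}
    {r : M → J → ℕ} {y : M → J → ℝ} {i : M} {𝒢 : Finset (Finset J)} {X : J → J → ℝ}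
    (h : IsGrouping p r y i 𝒢) (hr : IsSmithOrder w p r) (hw : ∀ j, 0 ≤ w j)
    (hp : ∀ j, 0 ≤ p i j) (hX : IsMoment X (y i)) (hy : ∀ j, 0 ≤ y i j) {P : J → J → ℝ}
    (hsymm : ∀ j j', P j j' = P j' j) (hdiag : ∀ j, P j j = y i j)
    (hP : ∀ j j', j ≠ j' → P j j' ≤ y i j * y i j')
    (hgroup : ∀ T ∈ 𝒢, ∀ j ∈ T, ∀ j' ∈ T, j ≠ j' →
      P j j' ≤ (1 - zetaConst) * (y i j * y i j')) :
    ∑ j, w j * ∑ j' with r i j' ≤ r i j, p i j' * P j j' ≤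
      (3 / 2 - zetaConst / 20000) * ∑ j, w j * ∑ j' with r i j' ≤ r i j, p i j' * X j j' := by
  set D : J → ℝ := fun j => (3 / 2 - zetaConst / 20000) *
    ∑ j' with r i j' ≤ r i j, p i j' * X j j' - ∑ j' with r i j' ≤ r i j, p i j' * P j j' with hD
  have hprefix : ∀ n, 0 ≤ ∑ j with r i j ≤ n, p i j * D j := by
    intro n
    have hle := h.prefix_cost_le (hr.injective i) hp hX hy hsymm hdiag hP hgroup
      (A := univ.filter fun j => r i j ≤ n) fun j hj j' hj' =>
        mem_filter.2 ⟨mem_univ _, hj'.trans (mem_filter.1 hj).2⟩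
    rw [← sub_nonneg, mul_sum, ← sum_sub_distrib] at hle
    refine hle.trans_eq (sum_congr rfl fun j _ => ?_)
    simp only [hD]
    ring
  -- The ratio is undefined where `p i j = 0`. If also `w j > 0`, the Smith order forces all earlier
  -- jobs to have size zero on `i`, so `D j = 0`; if `w j = 0` the term vanishes anyway.
  have hterm : ∀ j, w j * D j = if 0 < p i j then w j / p i j * (p i j * D j) else 0 := by
    intro j
    split_ifs with hpj
    · field_simp
    · have hp0 : p i j = 0 := le_antisymm (not_lt.1 hpj) (hp j)
      rcases (hw j).eq_or_lt with h0 | h0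
      · rw [← h0, zero_mul]
      · have hz : ∀ j', r i j' ≤ r i j → p i j' = 0 := by
          intro j' hj'
          rcases hj'.eq_or_lt with he | hlt
          · rw [hr.injective i he, hp0]
          · have hratio := hr.ratio i j j' hlt
            rw [hp0, mul_zero] at hratio
            exact le_antisymm (nonpos_of_mul_nonpos_right hratio h0) (hp j')
        have hsum : ∀ F : J → J → ℝ, ∑ j' with r i j' ≤ r i j, p i j' * F j j' = 0 := fun F =>
          sum_eq_zero fun j' hj' => by rw [hz j' (mem_filter.1 hj').2, zero_mul]
        simp only [hD, hsum]
        ring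
  have habel := sum_mul_nonneg_of_antitone (r := r i) (θ := fun j => w j / p i j)
    (f := fun j => p i j * D j) (univ.filter fun j => 0 < p i j) (fun j hj j' hj' hlt => by
      rw [div_le_div_iff₀ (mem_filter.1 hj).2 (mem_filter.1 hj').2]
      exact hr.ratio i j j' hlt) (fun n => by
      refine (hprefix n).trans_eq ?_
      rw [filter_filter, sum_filter, sum_filter]
      refine sum_congr rfl fun j _ => ?_
      by_cases hpj : 0 < p i j
      · simp [hpj]
      · have hp0 : p i j = 0 := le_antisymm (not_lt.1 hpj) (hp j)
        simp [hp0]) (hr.injective i) le_rfl (fun j _ => div_nonneg (hw j) (hp j))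
  rw [zero_mul, sum_filter, ← sum_congr rfl fun j _ => hterm j] at habel
  rw [← sub_nonneg, mul_sum, ← sum_sub_distrib]
  refine habel.trans_eq (sum_congr rfl fun j _ => ?_)
  simp only [hD]
  ring

theorem scheduleCost_eq [Fintype M] [Fintype J] [DecidableEq M] (w : J → ℝ) (p : M → J → ℝ)
    (r : M → J → ℕ) (a : J → M) :
    scheduleCost w p r a = ∑ i, ∑ j, w j * ∑ j' with r i j' ≤ r i j,
      p i j' * if a j = i ∧ a j' = i then 1 else 0 := by
  unfold scheduleCost completionTime
  rw [sum_comm]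
  refine sum_congr rfl fun j _ => ?_
  rw [← mul_sum, sum_eq_single_of_mem (a j) (mem_univ _)]
  · congr 1
    rw [sum_filter, sum_filter]
    refine sum_congr rfl fun j' _ => ?_
    by_cases h1 : a j' = a j <;> by_cases h2 : r (a j) j' ≤ r (a j) j <;> simp [h1, h2]
  · intro i _ hi
    exact sum_eq_zero fun j' _ => by simp [hi.symm]

theorem expectedCost_eq [Fintype M] [Fintype J] [DecidableEq M] [DecidableEq J] (w : J → ℝ)
    (p : M → J → ℝ) (r : M → J → ℕ) (μ : PMF (J → M)) :
    expectedCost w p r μ = ∑ i, ∑ j, w j * ∑ j' with r i j' ≤ r i j,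
      p i j' * pairProb μ i j j' := by
  unfold expectedCost pairProb
  simp_rw [scheduleCost_eq, mul_sum]
  rw [sum_comm]
  refine sum_congr rfl fun i _ => ?_
  rw [sum_comm]
  refine sum_congr rfl fun j _ => ?_
  rw [sum_comm]
  refine sum_congr rfl fun j' _ => ?_
  rw [sum_filter]
  refine sum_congr rfl fun a _ => ?_
  split_ifs <;> ring

theorem pairProb_comm [Fintype M] [Fintype J] [DecidableEq M] [DecidableEq J] (μ : PMF (J → M))
    (u : M) (a b : J) : pairProb μ u a b = pairProb μ u b a := by
  unfold pairProb
  simp only [and_comm]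

theorem IsAlgorithmOutput.expectedCost_le [Fintype M] [Fintype J] [DecidableEq M] [DecidableEq J]
    {w : J → ℝ} (hw : ∀ j, 0 ≤ w j) {p : M → J → ℝ} (hp : ∀ i j, 0 ≤ p i j)
    {r : M → J → ℕ} (hr : IsSmithOrder w p r) {x : M → Finset J → ℝ} (hx : SDPFeasible x)
    {μ : PMF (J → M)} (h : IsAlgorithmOutput p r x μ) :
    expectedCost w p r μ ≤ (3 / 2 - zetaConst / 20000) * sdpValue w p r x := by
  obtain ⟨G, hG, hround⟩ := h
  have hy := hx.isFractionalAssignment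
  rw [expectedCost_eq, sdpValue, mul_sum]
  refine sum_le_sum fun i _ => ?_
  exact (hG i).machine_cost_le hr hw (hp i) (hx.isMoment i) (hy.nonneg i)
    (P := fun j j' => pairProb μ i j j') (pairProb_comm μ i) (hround.pairProb_self hy i)
    (fun j j' hj => hround.pairProb_le hy i hj)
    (fun T hT j hj j' hj' hne => hround.pairProb_le_of_group hy
      (fun i => (hG i).pairwiseDisjoint) (fun i S hS => (hG i).card_le_one_or_sum_le hS)
      hT hj hj' hne)

end

theorem theorem3 {M J : Type*} [Fintype M] [Nonempty M] [DecidableEq M]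
    [Fintype J] [DecidableEq J]
    (w : J → ℝ) (hw : ∀ j, 0 ≤ w j) (p : M → J → ℝ) (hp : ∀ i j, 0 ≤ p i j)
    (r : M → J → ℕ) (hr : IsSmithOrder w p r) :
    (∃ x : M → Finset J → ℝ, IsSDPOptimal w p r x) ∧
    ∀ x : M → Finset J → ℝ, IsSDPOptimal w p r x →
      (∃ μ : PMF (J → M), IsAlgorithmOutput p r x μ) ∧
      ∀ μ : PMF (J → M), IsAlgorithmOutput p r x μ →
        expectedCost w p r μ ≤ (3 / 2 - zetaConst / 20000) * sdpValue w p r x := by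
  refine ⟨exists_isSDPOptimal w p r, fun x hx => ⟨?_, fun μ hμ => ?_⟩⟩
  · exact exists_isAlgorithmOutput p hr.injective hx.1.isFractionalAssignment
  · exact hμ.expectedCost_le hw hp hr hx.1
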